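/- Let $w=\{w_k\}_{k\ge 1}$ be a sequence of positive numbers with $w_k\to 1$, put $\beta_0=1$ and $\beta_k=w_1\cdots w_k$ for $k\ge 1$, and let $H^2_\beta$ be the Hilbert space of all analytic functions $f(z)=\sum_{k\ge 0}\widehat f(k)z^k$ on the open unit disk $\mathbb D$ with $\|f\|^2=\sum_{k\ge 0}|\widehat f(k)|^2\beta_k^2<\infty$. Assume that $H^2_\beta$ is of polynomial growth, that is, $\sup_{k\ge 1}(k+1)|w_k-1|<\infty$. Let $\varphi:\overline{\mathbb D}\to\overline{\mathbb D}$ be a nonconstant map that is analytic on (a neighbourhood of) the closed unit disk $\overline{\mathbb D}$, and write $\mathbb T=\partial\mathbb D$. Then $C_\varphi f=f\circ\varphi$ defines a bounded operator $C_\varphi$ on $H^2_\beta$, and the following are equivalent: 1. $C_\varphi$ is semi-Fredholm on $H^2_\beta$, i.e. $C_\varphi$ has closed range and at least one of $\dim\operatorname{Ker}C_\varphi<\infty$, $\dim\operatorname{Ker}C_\varphi^*<\infty$ holds; 2. $C_\varphi$ has closed range in $H^2_\beta$; 3. $\mathbb T\subseteq\varphi(\overline{\mathbb D})$; 4. $\varphi(\mathbb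 T)$ contains a (nondegenerate) arc of $\mathbb T$; 5. $\varphi$ is a finite Blaschke product, i.e. $\varphi(z)=c\prod_{j=1}^m\frac{z-a_j}{1-\overline{a_j}z}$ on $\overline{\mathbb D}$ for some $|c|=1$ and $a_1,\dots,a_m\in\mathbb D$. -/

import Mathlib

open Filter Topology Set
open scoped ComplexConjugate ENNReal

noncomputable section

/-- A sequence `w₁, w₂, …` of positive numbers with `wₖ → 1`. Only the values `w k` with `1 ≤ k`
are used; `w 0` is irrelevant. -/
structure WeightSequence where
  /-- the weights -/
  w : ℕ → ℝ
  pos : ∀ k, 1 ≤ k → 0 < w k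
  tendsto_one : Tendsto w atTop (𝓝 1)

namespace WeightSequence

/-- `β₀ = 1` and `βₖ = w₁ ⋯ wₖ`. -/
def beta (W : WeightSequence) (k : ℕ) : ℝ := ∏ j ∈ Finset.Icc 1 k, W.w j

/-- Polynomial growth: `sup_{k ≥ 1} (k + 1) |wₖ - 1| < ∞`. -/
def PolynomialGrowth (W : WeightSequence) : Prop :=
  BddAbove ((fun k : ℕ => ((k : ℝ) + 1) * |W.w k - 1|) '' Ici 1)

theorem beta_pos (W : WeightSequence) (k : ℕ) : 0 < W.beta k :=
  Finset.prod_pos fun j hj => W.pos j (Finset.mem_Icc.mp hj).1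

theorem beta_succ (W : WeightSequence) (k : ℕ) : W.beta (k + 1) = W.beta k * W.w (k + 1) := by
  simp [beta, Finset.prod_Icc_succ_top]

end WeightSequence

/-- The linear space of all Taylor coefficient sequences `a` with `∑ |aₖ|² βₖ² < ∞`. -/
def weightedHardySubmodule (W : WeightSequence) : Submodule ℂ (ℕ → ℂ) where
  carrier := {a | Summable fun k => ‖a k‖ ^ 2 * W.beta k ^ 2}
  zero_mem' := by simp [summable_zero]
  add_mem' := by
    intro a b ha hb
    refine Summable.of_nonneg_of_le (fun k => by positivity) (fun k => ?_)
      ((ha.mul_left 2).add (hb.mul_left 2))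
    have h1 : ‖a k + b k‖ ^ 2 ≤ 2 * ‖a k‖ ^ 2 + 2 * ‖b k‖ ^ 2 := by
      have := norm_add_le (a k) (b k)
      nlinarith [sq_nonneg (‖a k‖ - ‖b k‖), norm_nonneg (a k + b k)]
    have h2 : 0 ≤ W.beta k ^ 2 := by positivity
    simp only [Pi.add_apply]
    nlinarith
  smul_mem' := by
    intro c a ha
    refine (ha.mul_left (‖c‖ ^ 2)).congr fun k => ?_
    simp only [Pi.smul_apply, norm_smul]
    ring

/-- The weighted Hardy space `H²_β`. An element is an analytic function on the open unit disk,
recorded by its sequence of Taylor coefficients at `0`; the function itself is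
`WeightedHardy.eval`. -/
def WeightedHardy (W : WeightSequence) : Type := weightedHardySubmodule W

namespace WeightedHardy

variable {W : WeightSequence}

instance : AddCommGroup (WeightedHardy W) := inferInstanceAs (AddCommGroup (weightedHardySubmodule W))

instance : Module ℂ (WeightedHardy W) := inferInstanceAs (Module ℂ (weightedHardySubmodule W))

/-- The `k`-th Taylor coefficient of `f`. -/
def coeff (f : WeightedHardy W) (k : ℕ) : ℂ := f.1 k

/-- The element of `H²_β` with given Taylor coefficients. -/
def ofCoeff (a : ℕ → ℂ) (ha : Summable fun k => ‖a k‖ ^ 2 * W.beta k ^ 2) : WeightedHardy W :=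
  ⟨a, ha⟩

/-- The value `f(z) = ∑ₖ aₖ zᵏ`, for `z` in the open unit disk (where the series converges, see
`WeightedHardy.hasSum_eval`). -/
def eval (f : WeightedHardy W) (z : ℂ) : ℂ := ∑' k, f.coeff k * z ^ k

@[simp] theorem coeff_ofCoeff (a : ℕ → ℂ) (ha : Summable fun k => ‖a k‖ ^ 2 * W.beta k ^ 2)
    (k : ℕ) : (ofCoeff a ha).coeff k = a k := rfl

@[simp] theorem coeff_add (f g : WeightedHardy W) (k : ℕ) :
    (f + g).coeff k = f.coeff k + g.coeff k := rfl

@[simp] theorem coeff_smul (c : ℂ) (f : WeightedHardy W) (k : ℕ) :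
    (c • f).coeff k = c * f.coeff k := rfl

@[simp] theorem coeff_zero (k : ℕ) : (0 : WeightedHardy W).coeff k = 0 := rfl

@[ext] theorem ext {f g : WeightedHardy W} (h : ∀ k, f.coeff k = g.coeff k) : f = g :=
  Subtype.ext (funext h)

theorem summable_coeff (f : WeightedHardy W) :
    Summable fun k => ‖f.coeff k‖ ^ 2 * W.beta k ^ 2 := f.2

/-- The inner product `⟪f, g⟫ = ∑ₖ βₖ² conj(aₖ) bₖ` (conjugate linear in the first variable,
which is the library convention). -/
instance : Inner ℂ (WeightedHardy W) where
  inner f g := ∑' k, ((W.beta k ^ 2 : ℝ) : ℂ) * (conj (f.coeff k) * g.coeff k)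

theorem inner_def (f g : WeightedHardy W) :
    inner ℂ f g = ∑' k, ((W.beta k ^ 2 : ℝ) : ℂ) * (conj (f.coeff k) * g.coeff k) := rfl

/-- The linear bijection of `H²_β` with `ℓ²` that sends the Taylor coefficients `aₖ` to `βₖ aₖ`. -/
def toEll2 : WeightedHardy W ≃ₗ[ℂ] lp (fun _ : ℕ => ℂ) 2 where
  toFun f := ⟨fun k => (W.beta k : ℂ) * f.coeff k, by
    refine memℓp_gen ?_
    refine f.summable_coeff.congr fun k => ?_
    simp [abs_of_pos (W.beta_pos k), mul_pow, mul_comm]⟩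
  invFun x := ofCoeff (fun k => ((W.beta k)⁻¹ : ℂ) * x k) (by
    have hx := (lp.memℓp x).summable (by norm_num)
    refine hx.congr fun k => ?_
    have := (W.beta_pos k).ne'
    simp [mul_pow]
    field_simp)
  map_add' f g := by
    ext k
    change (W.beta k : ℂ) * (f.coeff k + g.coeff k) = W.beta k * f.coeff k + W.beta k * g.coeff k
    ring
  map_smul' c f := by
    ext k
    change (W.beta k : ℂ) * (c * f.coeff k) = c * (W.beta k * f.coeff k)
    ring
  left_inv f := by
    ext k
    have := (W.beta_pos k).ne'
    simp [this]
  right_inv x := by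
    ext k
    have := (W.beta_pos k).ne'
    simp [this]

@[simp] theorem toEll2_apply (f : WeightedHardy W) (k : ℕ) :
    toEll2 f k = (W.beta k : ℂ) * f.coeff k := rfl

theorem inner_toEll2 (f g : WeightedHardy W) :
    inner ℂ (toEll2 f) (toEll2 g) = inner ℂ f g := by
  rw [lp.inner_eq_tsum, inner_def]
  refine tsum_congr fun k => ?_
  simp
  ring

/-- The inner product axioms of `H²_β`. -/
@[reducible] def core : InnerProductSpace.Core ℂ (WeightedHardy W) where
  conj_inner_symm f g := by simp only [← inner_toEll2, inner_conj_symm]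
  re_inner_nonneg f := by
    rw [← inner_toEll2]
    exact inner_self_nonneg
  add_left f g h := by simp only [← inner_toEll2, map_add, inner_add_left]
  smul_left f g c := by simp only [← inner_toEll2, map_smul, inner_smul_left]
  definite f hf := by
    rw [← inner_toEll2, inner_self_eq_zero] at hf
    simpa using hf

instance : NormedAddCommGroup (WeightedHardy W) :=
  InnerProductSpace.Core.toNormedAddCommGroup (cd := core)

instance : InnerProductSpace ℂ (WeightedHardy W) := InnerProductSpace.ofCore core.toCore

/-- `toEll2` is an isometry, so `H²_β` is a Hilbert space. -/
def isometryEll2 : WeightedHardy W ≃ₗᵢ[ℂ] lp (fun _ : ℕ => ℂ) 2 :=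
  toEll2.isometryOfInner inner_toEll2

instance : CompleteSpace (WeightedHardy W) :=
  (completeSpace_congr (e := (isometryEll2 (W := W)).toEquiv)
    (isometryEll2 (W := W)).isometry.isUniformEmbedding).mpr inferInstance

theorem norm_sq (f : WeightedHardy W) :
    ‖f‖ ^ 2 = ∑' k, W.beta k ^ 2 * ‖f.coeff k‖ ^ 2 := by
  have h := inner_self_eq_norm_sq_to_K (𝕜 := ℂ) f
  rw [inner_def] at h
  apply Complex.ofReal_injective
  rw [Complex.ofReal_tsum]
  push_cast
  refine Eq.trans h.symm (tsum_congr fun k => ?_)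
  rw [Complex.conj_mul']
  push_cast
  ring

theorem hasSum_eval (f : WeightedHardy W) {z : ℂ} (hz : ‖z‖ < 1) :
    HasSum (fun k => f.coeff k * z ^ k) (f.eval z) := by
  obtain ⟨r, hzr, hr1⟩ := exists_between hz
  have hr0 : 0 < r := (norm_nonneg z).trans_lt hzr
  have hq : Summable fun k => (r ^ k / W.beta k) ^ 2 := by
    refine summable_of_ratio_test_tendsto_lt_one (l := (r / 1) ^ 2)
      (by rw [div_one]; nlinarith)
      (.of_forall fun k => pow_ne_zero _ (div_ne_zero (pow_ne_zero _ hr0.ne') (W.beta_pos k).ne')) ?_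
    have hw : Tendsto (fun k => (r / W.w (k + 1)) ^ 2) atTop (𝓝 ((r / 1) ^ 2)) :=
      (tendsto_const_nhds.div ((tendsto_add_atTop_iff_nat 1).mpr W.tendsto_one) one_ne_zero).pow 2
    refine hw.congr fun k => ?_
    have h1 := W.beta_pos k
    have h2 := W.pos (k + 1) (by omega)
    rw [W.beta_succ, Real.norm_of_nonneg (by positivity), Real.norm_of_nonneg (by positivity)]
    field_simp
    ring
  refine Summable.hasSum (Summable.of_norm_bounded (f.summable_coeff.add hq) fun k => ?_)
  have hb := W.beta_pos k
  have h1 : ‖f.coeff k * z ^ k‖ ≤ (‖f.coeff k‖ * W.beta k) * (r ^ k / W.beta k) := by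
    rw [norm_mul, norm_pow]
    have h2 : ‖z‖ ^ k ≤ r ^ k := pow_le_pow_left₀ (norm_nonneg z) hzr.le k
    calc ‖f.coeff k‖ * ‖z‖ ^ k ≤ ‖f.coeff k‖ * r ^ k := by gcongr
      _ = _ := by field_simp
  have h3 := two_mul_le_add_sq (‖f.coeff k‖ * W.beta k) (r ^ k / W.beta k)
  have h4 : 0 ≤ (‖f.coeff k‖ * W.beta k) * (r ^ k / W.beta k) := by positivity
  rw [← mul_pow]
  linarith

/-- An element of `H²_β` is determined by its values on the open unit disk. -/
theorem eval_injective {f g : WeightedHardy W} (h : ∀ z : ℂ, ‖z‖ < 1 → f.eval z = g.eval z) :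
    f = g := by
  have key : ∀ u : WeightedHardy W,
      HasFPowerSeriesAt u.eval (FormalMultilinearSeries.ofScalars ℂ u.coeff) 0 := by
    intro u
    rw [hasFPowerSeriesAt_iff]
    filter_upwards [Metric.ball_mem_nhds (0 : ℂ) one_pos] with z hz
    have := u.hasSum_eval (z := z) (by simpa using hz)
    simpa [FormalMultilinearSeries.coeff_ofScalars, mul_comm] using this
  have hg : HasFPowerSeriesAt f.eval (FormalMultilinearSeries.ofScalars ℂ g.coeff) 0 := by
    refine (key g).congr ?_
    filter_upwards [Metric.ball_mem_nhds (0 : ℂ) one_pos] with z hz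
    exact (h z (by simpa using hz)).symm
  have he := (key f).eq_formalMultilinearSeries hg
  ext k
  have := congrArg (fun p => p.coeff k) he
  simpa [FormalMultilinearSeries.coeff_ofScalars] using this

end WeightedHardy

/-- `T` is the composition operator `C_φ` on `H²_β`: `(T f)(z) = f(φ(z))` for all `f ∈ H²_β` and
all `z` in the open unit disk. There is at most one such `T`. -/
def IsCompositionOperator {W : WeightSequence} (φ : ℂ → ℂ)
    (T : WeightedHardy W →L[ℂ] WeightedHardy W) : Prop :=
  ∀ (f : WeightedHardy W) (z : ℂ), ‖z‖ < 1 → (T f).eval z = f.eval (φ z)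

theorem IsCompositionOperator.unique {W : WeightSequence} {φ : ℂ → ℂ}
    {S T : WeightedHardy W →L[ℂ] WeightedHardy W} (hS : IsCompositionOperator φ S)
    (hT : IsCompositionOperator φ T) : S = T :=
  ContinuousLinearMap.ext fun f =>
    WeightedHardy.eval_injective fun z hz => (hS f z hz).trans (hT f z hz).symm

/-- A bounded operator on a Hilbert space is semi-Fredholm if it has closed range and at least one
of `Ker T`, `Ker T*` is finite dimensional. -/
def IsSemiFredholm {H : Type*} [NormedAddCommGroup H] [InnerProductSpace ℂ H] [CompleteSpace H]
    (T : H →L[ℂ] H) : Prop :=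
  IsClosed (range T) ∧
    (FiniteDimensional ℂ (LinearMap.ker (T : H →ₗ[ℂ] H)) ∨
      FiniteDimensional ℂ (LinearMap.ker (ContinuousLinearMap.adjoint T : H →ₗ[ℂ] H)))

/-- A (closed, nondegenerate) arc of the unit circle. -/
def IsArc (J : Set ℂ) : Prop :=
  ∃ a b : ℝ, a < b ∧ J = circleMap 0 1 '' Icc a b

/-- On the closed unit disk `φ` is a finite Blaschke product
`c ∏ⱼ (z - aⱼ) / (1 - conj(aⱼ) z)` with `|c| = 1` and `|aⱼ| < 1`. -/
def IsFiniteBlaschkeProduct (φ : ℂ → ℂ) : Prop :=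
  ∃ (m : ℕ) (a : Fin m → ℂ) (c : ℂ), ‖c‖ = 1 ∧ (∀ j, ‖a j‖ < 1) ∧
    ∀ z ∈ Metric.closedBall (0 : ℂ) 1, φ z = c * ∏ j, (z - a j) / (1 - conj (a j) * z)

end

/-! Boundedness. Polynomial growth lets bounds for composition operators pass from the unweighted
space H² to H²_β. In the monomial basis, the entry (m, n) of C_φ is exponentially small in m + n
unless m and n are comparable. For m much larger than n this is Cauchy's estimate on a circle of
radius R > 1; for n much larger than m it is Cauchy's estimate on |z| = 1/2, where |φ| stays below
some q < 1. For comparable indices the weights β are comparable too, so an ℓ² bound becomes a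
weighted bound (`MatrixBound.weighted`). The ℓ² bound comes from Littlewood's subordination
principle when φ(0) = 0. For disk automorphisms it comes from an explicit orthogonal system, and
composing with an automorphism reduces the general case to φ(0) = 0.

Lower bound for Blaschke products. If |φ| = 1 on the circle and φ(0) = 0, composition preserves the
H² pairing, ⟨f∘φ, g∘φ⟩ = ⟨f, g⟩. The weights 1/β also have polynomial growth, so C_φ is bounded on
the dual space with weights 1/β, and duality bounds C_φ from below on H²_β
(`exists_norm_le_of_apply_zero`). Closed range and trivial kernel follow.

Converse. C_φ is injective because φ is nonconstant, so closed range means bounded below. If φ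
missed a point ξ of the circle, the powers of a peak function at ξ would contradict this
(`sphere_subset_image_of_norm_le`). Since |φ| < 1 inside the disk, points of the circle are attained
only on the circle. If φ(𝕋) contains an arc, the real-analytic function |φ(e^{iθ})|² equals 1
infinitely often on a compact interval, hence everywhere (`norm_eq_one_of_isArc`). Dividing out
zeros then exhibits φ as a finite Blaschke product. -/

/-! ### Taylor coefficients and Fourier analysis on the unit circle -/

/-- The `n`-th Taylor coefficient at `0`. -/
noncomputable def taylorCoeff (F : ℂ → ℂ) (n : ℕ) : ℂ := iteratedDeriv n F 0 / n.factorial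

/-- The points of analyticity form an open set, which contains a thickening of the compact disk.
This spare radius is the source of geometric decay of coefficients. -/
theorem exists_differentiableOn_closedBall {F : ℂ → ℂ}
    (hF : AnalyticOnNhd ℂ F (Metric.closedBall 0 1)) :
    ∃ R : ℝ, 1 < R ∧ DifferentiableOn ℂ F (Metric.closedBall 0 R) := by
  obtain ⟨δ, hδ, h⟩ := (isCompact_closedBall (0 : ℂ) 1).exists_cthickening_subset_open
    (isOpen_analyticAt ℂ F) hF
  rw [cthickening_closedBall hδ.le zero_le_one] at h
  exact ⟨δ + 1, by linarith, fun z hz => (h hz).differentiableAt.differentiableWithinAt⟩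

theorem norm_taylorCoeff_le {F : ℂ → ℂ} {R C : ℝ} (hR : 0 < R)
    (hF : DifferentiableOn ℂ F (Metric.closedBall 0 R))
    (hC : ∀ z ∈ Metric.sphere (0 : ℂ) R, ‖F z‖ ≤ C) (n : ℕ) : ‖taylorCoeff F n‖ ≤ C / R ^ n := by
  have h := Complex.norm_iteratedDeriv_le_of_forall_mem_sphere_norm_le n hR
    (hF.diffContOnCl_ball subset_rfl) hC
  rw [taylorCoeff, norm_div, Complex.norm_natCast, div_le_iff₀ (by positivity)]
  exact h.trans_eq (by ring)

theorem norm_taylorCoeff_le_geometric {F : ℂ → ℂ}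
    (hF : AnalyticOnNhd ℂ F (Metric.closedBall 0 1)) :
    ∃ R C : ℝ, 1 < R ∧ ∀ n, ‖taylorCoeff F n‖ ≤ C / R ^ n := by
  obtain ⟨R, hR, hd⟩ := exists_differentiableOn_closedBall hF
  obtain ⟨C, hC⟩ := (isCompact_sphere (0 : ℂ) R).exists_bound_of_continuousOn
    (hd.continuousOn.mono Metric.sphere_subset_closedBall)
  exact ⟨R, C, hR, norm_taylorCoeff_le (by linarith) hd hC⟩

theorem summable_norm_taylorCoeff {F : ℂ → ℂ}
    (hF : AnalyticOnNhd ℂ F (Metric.closedBall 0 1)) : Summable fun n => ‖taylorCoeff F n‖ := by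
  obtain ⟨R, C, hR, h⟩ := norm_taylorCoeff_le_geometric hF
  refine Summable.of_nonneg_of_le (fun _ => norm_nonneg _) h ?_
  have := (summable_geometric_of_lt_one (inv_nonneg.2 (by linarith))
    (inv_lt_one_of_one_lt₀ hR)).mul_left C
  simpa [div_eq_mul_inv] using this

theorem hasSum_taylorCoeff {F : ℂ → ℂ}
    (hF : AnalyticOnNhd ℂ F (Metric.closedBall 0 1)) {z : ℂ} (hz : z ∈ Metric.closedBall (0 : ℂ) 1) :
    HasSum (fun n => taylorCoeff F n * z ^ n) (F z) := by
  obtain ⟨R, hR, hd⟩ := exists_differentiableOn_closedBall hF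
  lift R to NNReal using by linarith
  have hz' : z ∈ Metric.ball (0 : ℂ) R := by
    simp only [Metric.mem_closedBall, dist_zero_right, Metric.mem_ball] at hz ⊢
    linarith
  have h := Complex.hasSum_taylorSeries_on_ball (hd.mono Metric.ball_subset_closedBall) hz'
  refine h.congr_fun fun n => ?_
  simp only [taylorCoeff, sub_zero, smul_eq_mul]
  ring

/-- Termwise integration of an absolutely convergent power series on the unit circle. -/
theorem hasSum_circleAverage_mul {K G : ℂ → ℂ} {b : ℕ → ℂ}
    (hK : ContinuousOn K (Metric.sphere 0 1)) (hb : Summable fun n => ‖b n‖)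
    (hG : ∀ z ∈ Metric.sphere (0 : ℂ) 1, HasSum (fun n => b n * z ^ n) (G z)) :
    HasSum (fun n => b n * Real.circleAverage (fun z => K z * z ^ n) 0 1)
      (Real.circleAverage (fun z => K z * G z) 0 1) := by
  obtain ⟨M, hM⟩ := (isCompact_sphere (0 : ℂ) 1).exists_bound_of_continuousOn hK
  have hs : ∀ θ : ℝ, circleMap 0 1 θ ∈ Metric.sphere (0 : ℂ) 1 := fun θ =>
    circleMap_mem_sphere _ zero_le_one _
  have hKc : Continuous fun θ : ℝ => K (circleMap 0 1 θ) :=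
    hK.comp_continuous (continuous_circleMap 0 1) hs
  have key := intervalIntegral.hasSum_integral_of_dominated_convergence (a := 0)
    (b := 2 * Real.pi) (μ := MeasureTheory.volume)
    (F := fun n θ => K (circleMap 0 1 θ) * (b n * circleMap 0 1 θ ^ n))
    (f := fun θ => K (circleMap 0 1 θ) * G (circleMap 0 1 θ))
    (fun n _ => M * ‖b n‖) (fun n => ?_) (fun n => ?_) ?_ ?_ ?_
  · have := key.const_smul ((2 * Real.pi)⁻¹ : ℝ)
    refine this.congr_fun fun n => ?_
    simp only [Real.circleAverage, Complex.real_smul, mul_left_comm _ (b n),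
      intervalIntegral.integral_const_mul]
  · exact (hKc.mul (continuous_const.mul ((continuous_circleMap 0 1).pow n))).aestronglyMeasurable
  · refine .of_forall fun θ _ => ?_
    rw [norm_mul, norm_mul, norm_pow, norm_circleMap_zero]
    have := hM _ (hs θ)
    simp only [abs_one, one_pow, mul_one]
    gcongr
  · exact .of_forall fun θ _ => hb.mul_left M
  · exact intervalIntegrable_const
  · exact .of_forall fun θ _ => (hG _ (hs θ)).mul_left _

theorem circleAverage_conj (F : ℂ → ℂ) :
    Real.circleAverage (fun z => conj (F z)) 0 1 = conj (Real.circleAverage F 0 1) := by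
  simp only [Real.circleAverage, Complex.real_smul, map_mul, Complex.conj_ofReal]
  rw [intervalIntegral.intervalIntegral_conj]

theorem AnalyticOnNhd.circleAverage_eq {F : ℂ → ℂ}
    (hF : AnalyticOnNhd ℂ F (Metric.closedBall 0 1)) : Real.circleAverage F 0 1 = F 0 :=
  DiffContOnCl.circleAverage (by
    rw [abs_one]
    exact hF.differentiableOn.diffContOnCl_ball subset_rfl)

theorem conj_mul_self_of_norm_eq_one {z : ℂ} (hz : ‖z‖ = 1) : conj z * z = 1 := by
  rw [Complex.conj_mul', hz]; simp

/-- The powers of an analytic function that is unimodular on the circle and vanishes at `0` are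
orthonormal. -/
theorem circleAverage_conj_pow_mul_pow {φ : ℂ → ℂ}
    (hφ : AnalyticOnNhd ℂ φ (Metric.closedBall 0 1))
    (h1 : ∀ z ∈ Metric.sphere (0 : ℂ) 1, ‖φ z‖ = 1) (h0 : φ 0 = 0) (k n : ℕ) :
    Real.circleAverage (fun z => conj (φ z ^ k) * φ z ^ n) 0 1 = if k = n then 1 else 0 := by
  -- Unimodularity cancels the common factor φ^k, and the mean value property leaves φ(0)^j. The
  -- case k > n follows by conjugation.
  have key : ∀ k j : ℕ, Real.circleAverage (fun z => conj (φ z ^ k) * φ z ^ (k + j)) 0 1 =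
      if j = 0 then 1 else 0 := by
    intro k j
    have : Real.circleAverage (fun z => conj (φ z ^ k) * φ z ^ (k + j)) 0 1 =
        Real.circleAverage (fun z => φ z ^ j) 0 1 := by
      refine Real.circleAverage_congr_sphere fun z hz => ?_
      rw [abs_one] at hz
      rw [pow_add, ← mul_assoc, map_pow, ← mul_pow, conj_mul_self_of_norm_eq_one (h1 z hz),
        one_pow, one_mul]
    rw [this, AnalyticOnNhd.circleAverage_eq (F := fun z => φ z ^ j) (hφ.pow j), h0, zero_pow_eq]
  rcases le_total k n with h | h
  · obtain ⟨j, rfl⟩ := Nat.exists_eq_add_of_le h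
    rw [key]; simp
  · obtain ⟨j, rfl⟩ := Nat.exists_eq_add_of_le h
    have := key n j
    apply_fun conj at this
    rw [← circleAverage_conj] at this
    simp only [map_mul, Complex.conj_conj] at this
    simp only [mul_comm (conj _)]
    rw [this]
    simp [apply_ite]

/-- **Parseval's identity** on the unit circle. -/
theorem hasSum_conj_taylorCoeff_mul {F G : ℂ → ℂ}
    (hF : AnalyticOnNhd ℂ F (Metric.closedBall 0 1))
    (hG : AnalyticOnNhd ℂ G (Metric.closedBall 0 1)) :
    HasSum (fun n => conj (taylorCoeff F n) * taylorCoeff G n)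
      (Real.circleAverage (fun z => conj (F z) * G z) 0 1) := by
  have hsub := Metric.sphere_subset_closedBall (x := (0 : ℂ)) (ε := 1)
  -- Fourier coefficients of F: integrate its Taylor series termwise and use orthonormality of the
  -- powers of the identity map.
  have hF' : ∀ n, Real.circleAverage (fun z => conj (F z) * z ^ n) 0 1 = conj (taylorCoeff F n) := by
    intro n
    have h1 := hasSum_circleAverage_mul (K := fun z => conj (z ^ n)) (by fun_prop)
      (summable_norm_taylorCoeff hF) fun z hz => hasSum_taylorCoeff hF (hsub hz)
    have h2 : ∀ k, taylorCoeff F k * Real.circleAverage (fun z => conj (z ^ n) * z ^ k) 0 1 =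
        if k = n then taylorCoeff F n else 0 := by
      intro k
      rw [circleAverage_conj_pow_mul_pow (φ := fun z => z) analyticOnNhd_id (by simp) rfl]
      by_cases h : k = n
      · simp [h]
      · simp [h, Ne.symm h]
    simp only [h2] at h1
    rw [(hasSum_ite_eq n _).unique h1, ← circleAverage_conj]
    simp only [map_mul, Complex.conj_conj, mul_comm]
  have := hasSum_circleAverage_mul (K := fun z => conj (F z))
    (Complex.continuous_conj.comp_continuousOn (hF.continuousOn.mono hsub))
    (summable_norm_taylorCoeff hG) fun z hz => hasSum_taylorCoeff hG (hsub hz)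
  simpa only [hF', mul_comm (taylorCoeff G _)] using this

/-! ### Weights of polynomial growth -/

namespace WeightSequence

/-- The reciprocal weights. -/
noncomputable def inv (W : WeightSequence) : WeightSequence where
  w k := (W.w k)⁻¹
  pos k hk := inv_pos.2 (W.pos k hk)
  tendsto_one := by simpa using W.tendsto_one.inv₀ one_ne_zero

theorem beta_inv (W : WeightSequence) (k : ℕ) : W.inv.beta k = (W.beta k)⁻¹ := by
  simp [beta, inv]

/-- |1/w - 1| = |w - 1|/w, and 1/w_k is bounded because w_k → 1. The reciprocal weights serve twice:
they turn upper estimates of β into lower ones, and they describe the dual space. -/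
theorem PolynomialGrowth.inv {W : WeightSequence} (hW : W.PolynomialGrowth) :
    W.inv.PolynomialGrowth := by
  obtain ⟨M, hM⟩ := hW
  obtain ⟨B, hB⟩ := (W.tendsto_one.inv₀ one_ne_zero).bddAbove_range
  refine ⟨M * B, ?_⟩
  rintro _ ⟨k, hk, rfl⟩
  have h1 : ((k : ℝ) + 1) * |W.w k - 1| ≤ M := hM ⟨k, hk, rfl⟩
  have h2 : (W.w k)⁻¹ ≤ B := hB ⟨k, rfl⟩
  have hp := W.pos k hk
  have h3 : |W.inv.w k - 1| = |W.w k - 1| * (W.w k)⁻¹ := by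
    have : W.inv.w k - 1 = (1 - W.w k) * (W.w k)⁻¹ := by
      simp only [WeightSequence.inv]
      field_simp
    rw [this, abs_mul, abs_sub_comm, abs_of_pos (inv_pos.2 hp)]
  change ((k : ℝ) + 1) * |W.inv.w k - 1| ≤ M * B
  rw [h3, ← mul_assoc]
  have : 0 ≤ ((k : ℝ) + 1) * |W.w k - 1| := by positivity
  have := inv_pos.2 hp
  gcongr
  linarith

/-- Each factor satisfies w_k ≤ exp(M/(k+1)), and the d factors from a + 1 to a + d all have
exponent at most M/(a+1). -/
theorem PolynomialGrowth.beta_le_mul_exp {W : WeightSequence} (hW : W.PolynomialGrowth) :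
    ∃ M : ℝ, 0 ≤ M ∧ ∀ a d : ℕ, W.beta (a + d) ≤ W.beta a * Real.exp (M * d / (a + 1)) := by
  obtain ⟨M, hM⟩ := hW
  have hw : ∀ k, 1 ≤ k → W.w k ≤ Real.exp (M / (k + 1)) := by
    intro k hk
    have h1 : ((k : ℝ) + 1) * |W.w k - 1| ≤ M := hM ⟨k, hk, rfl⟩
    have h2 : |W.w k - 1| ≤ M / (k + 1) := by
      rw [le_div_iff₀ (by positivity)]; linarith
    have := Real.add_one_le_exp (M / ((k : ℝ) + 1))
    linarith [le_abs_self (W.w k - 1)]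
  have hM0 : 0 ≤ M := le_trans (by positivity) (hM ⟨1, le_refl 1, rfl⟩)
  refine ⟨M, hM0, fun a d => ?_⟩
  induction d with
  | zero => simp
  | succ d ih =>
    rw [← add_assoc, beta_succ]
    have h1 : W.w (a + d + 1) ≤ Real.exp (M / (a + 1)) := by
      refine (hw _ (by omega)).trans (Real.exp_le_exp.2 ?_)
      gcongr
      linarith [show (0 : ℝ) ≤ d from d.cast_nonneg]
    calc W.beta (a + d) * W.w (a + d + 1)
        ≤ (W.beta a * Real.exp (M * d / (a + 1))) * Real.exp (M / (a + 1)) := by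
          have := W.beta_pos a
          have := W.pos (a + d + 1) (by omega)
          gcongr
      _ = _ := by
          rw [mul_assoc, ← Real.exp_add]
          congr 2
          push_cast
          ring

/-- Weights of polynomial growth are comparable at comparable indices. -/
theorem PolynomialGrowth.exists_beta_le {W : WeightSequence} (hW : W.PolynomialGrowth) (Λ : ℕ) :
    ∃ c : ℝ, 0 < c ∧ ∀ a b : ℕ, a + 1 ≤ Λ * (b + 1) → b + 1 ≤ Λ * (a + 1) →
      W.beta a ≤ c * W.beta b := by
  obtain ⟨M, hM, h⟩ := hW.beta_le_mul_exp
  obtain ⟨M', hM', h'⟩ := hW.inv.beta_le_mul_exp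
  have key : ∀ (N : ℝ) (a d : ℕ), 0 ≤ N → a + d + 1 ≤ Λ * (a + 1) → N ≤ M + M' →
      Real.exp (N * d / (a + 1)) ≤ Real.exp ((M + M') * Λ) := by
    intro N a d hN hd hNM
    refine Real.exp_le_exp.2 ?_
    rw [mul_div_assoc]
    have : (d : ℝ) / (a + 1) ≤ Λ := by
      rw [div_le_iff₀ (by positivity)]
      have : d ≤ Λ * (a + 1) := by omega
      exact_mod_cast this
    gcongr
  refine ⟨Real.exp ((M + M') * Λ), Real.exp_pos _, fun a b hab hba => ?_⟩
  rcases le_total a b with hle | hle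
  · obtain ⟨d, rfl⟩ := Nat.exists_eq_add_of_le hle
    have h1 := h' a d
    have h2 := key M' a d hM' hba (by linarith)
    have ha := W.beta_pos a
    have hb := W.beta_pos (a + d)
    rw [beta_inv, beta_inv, inv_le_iff_one_le_mul₀ hb, mul_assoc, inv_mul_eq_div,
      le_div_iff₀ ha, one_mul] at h1
    exact h1.trans (by gcongr)
  · obtain ⟨d, rfl⟩ := Nat.exists_eq_add_of_le hle
    have hb := W.beta_pos b
    calc _ ≤ _ := h b d
      _ ≤ W.beta b * Real.exp ((M + M') * Λ) := by
        have := key M b d hM hab (by linarith)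
        gcongr
      _ = _ := mul_comm _ _

/-- β grows subexponentially because w_k → 1: consecutive terms have ratio tending to ρ. -/
theorem summable_beta_sq_mul_pow (W : WeightSequence) {ρ : ℝ} (h0 : 0 < ρ) (h1 : ρ < 1) :
    Summable fun k => W.beta k ^ 2 * ρ ^ k := by
  refine summable_of_ratio_test_tendsto_lt_one (l := 1 ^ 2 * ρ) (by simpa using h1)
    (.of_forall fun k => (mul_pos (pow_pos (W.beta_pos k) 2) (pow_pos h0 k)).ne') ?_
  have hw : Tendsto (fun k => W.w (k + 1) ^ 2 * ρ) atTop (𝓝 (1 ^ 2 * ρ)) :=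
    (((tendsto_add_atTop_iff_nat 1).mpr W.tendsto_one).pow 2).mul_const ρ
  refine hw.congr fun k => ?_
  have hb := W.beta_pos k
  have h2 := W.pos (k + 1) (by omega)
  rw [W.beta_succ, Real.norm_of_nonneg (by positivity), Real.norm_of_nonneg (by positivity)]
  field_simp
  ring

end WeightSequence

/-! ### From ℓ² bounds to weighted bounds -/

/-- The matrix `a` is bounded by `√C` on the `ℓ²` space with weights `β`, tested on finite
sequences. -/
def MatrixBound (β : ℕ → ℝ) (a : ℕ → ℕ → ℂ) (C : ℝ) : Prop :=
  ∀ (s t : Finset ℕ) (x : ℕ → ℂ),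
    ∑ m ∈ t, β m ^ 2 * ‖∑ n ∈ s, a m n * x n‖ ^ 2 ≤ C * ∑ n ∈ s, β n ^ 2 * ‖x n‖ ^ 2

/-- Indices are grouped into blocks by `Nat.log L`. Skipping a whole block forces a ratio above L,
so the entry lies in the region of geometric decay. -/
theorem mul_lt_of_log_add_two_le {L m n : ℕ} (hL : 2 ≤ L) (h : Nat.log L n + 2 ≤ Nat.log L m) :
    L * n < m := by
  have hm : m ≠ 0 := by rintro rfl; simp at h
  calc L * n < L * L ^ (Nat.log L n + 1) := by
        have := Nat.lt_pow_succ_log_self (b := L) (by omega) n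
        gcongr
    _ = L ^ (Nat.log L n + 2) := by ring
    _ ≤ L ^ Nat.log L m := Nat.pow_le_pow_right (by omega) h
    _ ≤ m := Nat.pow_log_le_self L hm

/-- Neighbouring blocks contain comparable indices. The shift by 1 is needed because 0 belongs to
the first block. -/
theorem succ_le_mul_of_log_le {L m n : ℕ} (hL : 2 ≤ L) (h : Nat.log L m ≤ Nat.log L n + 1) :
    m + 1 ≤ L ^ 2 * (n + 1) := by
  have h1 : L ^ Nat.log L n ≤ n + 1 := by
    rcases eq_or_ne n 0 with rfl | hn
    · simp
    · exact (Nat.pow_log_le_self L hn).trans (Nat.le_succ n)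
  calc m + 1 ≤ L ^ (Nat.log L m + 1) := Nat.lt_pow_succ_log_self (by omega) m
    _ ≤ L ^ (Nat.log L n + 2) := Nat.pow_le_pow_right (by omega) (by omega)
    _ = L ^ 2 * L ^ Nat.log L n := by ring
    _ ≤ _ := by gcongr

/-- Part of a weighted matrix estimate that comes from entries in neighbouring `L`-adic blocks. -/
theorem MatrixBound.near_le {β : ℕ → ℝ} {a : ℕ → ℕ → ℂ} {C c : ℝ} {L : ℕ} (hL : 2 ≤ L)
    (hC : 0 ≤ C)
    (hβ : ∀ n, 0 < β n)
    (hβc : ∀ m n, Nat.log L m ≤ Nat.log L n + 1 → Nat.log L n ≤ Nat.log L m + 1 → β m ≤ c * β n)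
    (h : MatrixBound (fun _ => 1) a C) (s t : Finset ℕ) (x : ℕ → ℂ) :
    ∑ m ∈ t, β m ^ 2 * ‖∑ n ∈ s with (Nat.log L m ≤ Nat.log L n + 1 ∧ Nat.log L n ≤ Nat.log L m + 1),
        a m n * x n‖ ^ 2 ≤ 3 * c ^ 4 * C * ∑ n ∈ s, β n ^ 2 * ‖x n‖ ^ 2 := by
  set N : ℕ → Finset ℕ := fun j => {n ∈ s | j ≤ Nat.log L n + 1 ∧ Nat.log L n ≤ j + 1} with hN
  set J := t.sup (Nat.log L) + 1
  have hlog : ∀ j, Nat.log L (L ^ j) = j := fun j => Nat.log_pow (by omega) j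
  -- On a block and its neighbours β may be replaced by the constant β(L^j). Doing so on the output
  -- and on the input costs c² each time, hence c⁴.
  have hblock : ∀ j, ∑ m ∈ t with Nat.log L m = j, β m ^ 2 * ‖∑ n ∈ N (Nat.log L m), a m n * x n‖ ^ 2 ≤
      c ^ 4 * C * ∑ n ∈ N j, β n ^ 2 * ‖x n‖ ^ 2 := by
    intro j
    have hb := hβ (L ^ j)
    calc ∑ m ∈ t with Nat.log L m = j, β m ^ 2 * ‖∑ n ∈ N (Nat.log L m), a m n * x n‖ ^ 2
        ≤ ∑ m ∈ t with Nat.log L m = j, (c * β (L ^ j)) ^ 2 * ‖∑ n ∈ N j, a m n * x n‖ ^ 2 := by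
          refine Finset.sum_le_sum fun m hm => ?_
          have hm' := (Finset.mem_filter.1 hm).2
          have := hβc m (L ^ j) (by rw [hlog]; omega) (by rw [hlog]; omega)
          have := (hβ m).le
          rw [hm']
          gcongr
      _ = (c * β (L ^ j)) ^ 2 * ∑ m ∈ t with Nat.log L m = j, (1 : ℝ) ^ 2 * ‖∑ n ∈ N j, a m n * x n‖ ^ 2 := by
          simp only [Finset.mul_sum, one_pow, one_mul]
      _ ≤ (c * β (L ^ j)) ^ 2 * (C * ∑ n ∈ N j, (1 : ℝ) ^ 2 * ‖x n‖ ^ 2) := by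
          gcongr
          exact h (N j) _ x
      _ = c ^ 2 * C * ∑ n ∈ N j, β (L ^ j) ^ 2 * ‖x n‖ ^ 2 := by
          simp only [Finset.mul_sum]
          exact Finset.sum_congr rfl fun _ _ => by ring
      _ ≤ c ^ 2 * C * ∑ n ∈ N j, (c * β n) ^ 2 * ‖x n‖ ^ 2 := by
          gcongr with n hn
          have hn' := (Finset.mem_filter.1 hn).2
          exact hβc _ _ (by rw [hlog]; exact hn'.1) (by rw [hlog]; exact hn'.2)
      _ = _ := by
          simp only [Finset.mul_sum]
          exact Finset.sum_congr rfl fun _ _ => by ring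
  have hmaps : ∀ m ∈ t, Nat.log L m ∈ Finset.range J := fun m hm =>
    Finset.mem_range.2 (Nat.lt_succ_of_le (Finset.le_sup (f := Nat.log L) hm))
  change ∑ m ∈ t, β m ^ 2 * ‖∑ n ∈ N (Nat.log L m), a m n * x n‖ ^ 2 ≤ _
  rw [← Finset.sum_fiberwise_of_maps_to hmaps]
  calc _ ≤ ∑ j ∈ Finset.range J, c ^ 4 * C * ∑ n ∈ N j, β n ^ 2 * ‖x n‖ ^ 2 :=
        Finset.sum_le_sum fun j _ => hblock j
    _ = c ^ 4 * C * ∑ j ∈ Finset.range J, ∑ n ∈ N j, β n ^ 2 * ‖x n‖ ^ 2 := by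
        rw [Finset.mul_sum]
    _ = c ^ 4 * C * ∑ n ∈ s, ∑ j ∈ Finset.range J with (j ≤ Nat.log L n + 1 ∧ Nat.log L n ≤ j + 1),
          β n ^ 2 * ‖x n‖ ^ 2 := by
        congr 1
        simp only [hN, Finset.sum_filter]
        exact Finset.sum_comm
    _ ≤ c ^ 4 * C * ∑ n ∈ s, 3 * (β n ^ 2 * ‖x n‖ ^ 2) := by
        gcongr with n hn
        rw [Finset.sum_const, nsmul_eq_mul]
        gcongr
        -- Each n is counted for at most three blocks j, which gives the factor 3. Truncated
        -- subtraction at block 0 only shortens the interval.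
        have : Finset.card {j ∈ Finset.range J | j ≤ Nat.log L n + 1 ∧ Nat.log L n ≤ j + 1} ≤
            (Finset.Icc (Nat.log L n - 1) (Nat.log L n + 1)).card :=
          Finset.card_le_card fun j hj => by
            simp only [Finset.mem_filter, Finset.mem_Icc] at hj ⊢
            omega
        rw [Nat.card_Icc] at this
        exact_mod_cast this.trans (by omega)
    _ = _ := by rw [← Finset.mul_sum]; ring

/-- A bounded matrix on `ℓ²` with geometrically small entries far from the diagonal is bounded on
every weighted space of polynomial growth. -/
theorem MatrixBound.weighted {W : WeightSequence} (hW : W.PolynomialGrowth) {a : ℕ → ℕ → ℂ}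
    {C : ℝ} (hC : 0 ≤ C) (h : MatrixBound (fun _ => 1) a C) {L : ℕ} (hL : 2 ≤ L) {ρ : ℝ}
    (hρ : 0 < ρ) (hρ1 : ρ < 1)
    (hfar : ∀ m n, L * n < m ∨ L * m < n → ‖a m n‖ ≤ ρ ^ (m + n)) :
    ∃ C', 0 ≤ C' ∧ MatrixBound W.beta a C' := by
  obtain ⟨c, hc, hcomp⟩ := hW.exists_beta_le (L ^ 2)
  have hρ2 : ρ ^ 2 < 1 := by nlinarith
  have hs1 := W.summable_beta_sq_mul_pow (pow_pos hρ 2) hρ2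
  have hs2 := W.inv.summable_beta_sq_mul_pow (pow_pos hρ 2) hρ2
  set S := ∑' k, W.beta k ^ 2 * (ρ ^ 2) ^ k
  set S' := ∑' k, W.inv.beta k ^ 2 * (ρ ^ 2) ^ k
  have hS : 0 ≤ S := tsum_nonneg fun _ => by positivity
  have hS' : 0 ≤ S' := tsum_nonneg fun _ => by positivity
  refine ⟨2 * (3 * c ^ 4 * C) + 2 * (S * S'), by positivity, fun s t x => ?_⟩
  have hnear := h.near_le hL hC W.beta_pos (fun m n h1 h2 =>
    hcomp m n (succ_le_mul_of_log_le hL h1) (succ_le_mul_of_log_le hL h2)) s t x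
  set X := ∑ n ∈ s, W.beta n ^ 2 * ‖x n‖ ^ 2
  have hX : 0 ≤ X := Finset.sum_nonneg fun _ _ => by positivity
  -- The far part is dominated by the rank-one matrix ρ^m ρ^n. Cauchy–Schwarz is applied to ρ^n
  -- |x_n| = (ρ^n/β_n)(β_n |x_n|), so the reciprocal weights enter through S'.
  have hfar' : ∀ m, ‖∑ n ∈ s with ¬ (Nat.log L m ≤ Nat.log L n + 1 ∧ Nat.log L n ≤ Nat.log L m + 1),
      a m n * x n‖ ^ 2 ≤ (ρ ^ 2) ^ m * (S' * X) := by
    intro m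
    have h1 : ‖∑ n ∈ s with ¬ (Nat.log L m ≤ Nat.log L n + 1 ∧ Nat.log L n ≤ Nat.log L m + 1),
        a m n * x n‖ ≤ ρ ^ m * ∑ n ∈ s, (W.inv.beta n * ρ ^ n) * (W.beta n * ‖x n‖) := by
      calc _ ≤ ∑ n ∈ s with ¬ (Nat.log L m ≤ Nat.log L n + 1 ∧ Nat.log L n ≤ Nat.log L m + 1),
            ρ ^ (m + n) * ‖x n‖ := by
            refine norm_sum_le_of_le _ fun n hn => ?_
            rw [norm_mul]
            gcongr
            refine hfar m n ?_
            have := (Finset.mem_filter.1 hn).2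
            rcases le_or_gt (Nat.log L m) (Nat.log L n + 1) with h3 | h3
            · exact Or.inr (mul_lt_of_log_add_two_le hL (by omega))
            · exact Or.inl (mul_lt_of_log_add_two_le hL (by omega))
        _ ≤ ∑ n ∈ s, ρ ^ (m + n) * ‖x n‖ :=
            Finset.sum_le_sum_of_subset_of_nonneg (Finset.filter_subset _ _)
              fun _ _ _ => by positivity
        _ = _ := by
            rw [Finset.mul_sum]
            refine Finset.sum_congr rfl fun n _ => ?_
            have := (W.beta_pos n).ne'
            rw [W.beta_inv]
            field_simp
            ring
    calc _ ≤ (ρ ^ m * ∑ n ∈ s, (W.inv.beta n * ρ ^ n) * (W.beta n * ‖x n‖)) ^ 2 := by gcongr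
      _ = (ρ ^ 2) ^ m * (∑ n ∈ s, (W.inv.beta n * ρ ^ n) * (W.beta n * ‖x n‖)) ^ 2 := by ring
      _ ≤ (ρ ^ 2) ^ m * ((∑ n ∈ s, (W.inv.beta n * ρ ^ n) ^ 2) * ∑ n ∈ s, (W.beta n * ‖x n‖) ^ 2) := by
          gcongr
          exact Finset.sum_mul_sq_le_sq_mul_sq _ _ _
      _ ≤ _ := by
          have e1 : ∑ n ∈ s, (W.inv.beta n * ρ ^ n) ^ 2 ≤ S' := by
            refine (Finset.sum_congr rfl fun n _ => ?_).trans_le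
              (hs2.sum_le_tsum s fun _ _ => by positivity)
            ring
          have e2 : ∑ n ∈ s, (W.beta n * ‖x n‖) ^ 2 = X :=
            Finset.sum_congr rfl fun n _ => by ring
          rw [e2]
          gcongr
  have hsplit : ∀ m, W.beta m ^ 2 * ‖∑ n ∈ s, a m n * x n‖ ^ 2 ≤
      2 * (W.beta m ^ 2 * ‖∑ n ∈ s with (Nat.log L m ≤ Nat.log L n + 1 ∧ Nat.log L n ≤ Nat.log L m + 1),
        a m n * x n‖ ^ 2) + 2 * ((W.beta m ^ 2 * (ρ ^ 2) ^ m) * (S' * X)) := by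
    intro m
    rw [← Finset.sum_filter_add_sum_filter_not s
      (fun n => Nat.log L m ≤ Nat.log L n + 1 ∧ Nat.log L n ≤ Nat.log L m + 1)]
    set u := ∑ n ∈ s with (Nat.log L m ≤ Nat.log L n + 1 ∧ Nat.log L n ≤ Nat.log L m + 1), a m n * x n
    have h1 := hfar' m
    set v := ∑ n ∈ s with ¬ (Nat.log L m ≤ Nat.log L n + 1 ∧ Nat.log L n ≤ Nat.log L m + 1),
      a m n * x n
    have h2 : ‖u + v‖ ^ 2 ≤ 2 * ‖u‖ ^ 2 + 2 * ‖v‖ ^ 2 := by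
      have := norm_add_le u v
      nlinarith [sq_nonneg (‖u‖ - ‖v‖), norm_nonneg (u + v)]
    have h3 : ‖u + v‖ ^ 2 ≤ 2 * ‖u‖ ^ 2 + 2 * ((ρ ^ 2) ^ m * (S' * X)) := by linarith
    calc _ ≤ W.beta m ^ 2 * (2 * ‖u‖ ^ 2 + 2 * ((ρ ^ 2) ^ m * (S' * X))) := by gcongr
      _ = _ := by ring
  calc _ ≤ _ := Finset.sum_le_sum fun m _ => hsplit m
    _ = 2 * (∑ m ∈ t, W.beta m ^ 2 * ‖∑ n ∈ s with (Nat.log L m ≤ Nat.log L n + 1 ∧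
          Nat.log L n ≤ Nat.log L m + 1), a m n * x n‖ ^ 2) +
        2 * ((∑ m ∈ t, W.beta m ^ 2 * (ρ ^ 2) ^ m) * (S' * X)) := by
        rw [Finset.sum_add_distrib, ← Finset.mul_sum, ← Finset.mul_sum, Finset.sum_mul]
    _ ≤ 2 * (3 * c ^ 4 * C * X) + 2 * (S * (S' * X)) := by
        gcongr
        exact hs1.sum_le_tsum t fun _ _ => by positivity
    _ = _ := by ring

/-! ### Monomials, point evaluations and operators given by matrices -/

namespace WeightedHardy

variable {W : WeightSequence}

/-- The monomial `zⁿ`. -/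
noncomputable def monomial (W : WeightSequence) (n : ℕ) : WeightedHardy W :=
  ofCoeff (Pi.single n 1) (summable_of_ne_finset_zero (s := {n}) fun k hk => by
    simp [Pi.single_eq_of_ne (Finset.notMem_singleton.1 hk)])

theorem coeff_monomial (n k : ℕ) : (monomial W n).coeff k = if k = n then 1 else 0 := by
  simp [monomial, Pi.single_apply]

theorem coeff_sum {ι : Type*} (s : Finset ι) (c : ι → ℂ) (v : ι → WeightedHardy W) (k : ℕ) :
    (∑ i ∈ s, c i • v i).coeff k = ∑ i ∈ s, c i * (v i).coeff k := by
  classical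
  induction s using Finset.induction_on with
  | empty => simp
  | insert i s hi ih => rw [Finset.sum_insert hi, Finset.sum_insert hi, coeff_add, ih, coeff_smul]

theorem coeff_linearCombination (v : ℕ → WeightedHardy W) (x : ℕ →₀ ℂ) (k : ℕ) :
    (Finsupp.linearCombination ℂ v x).coeff k = ∑ n ∈ x.support, x n * (v n).coeff k := by
  rw [Finsupp.linearCombination_apply, Finsupp.sum, coeff_sum]

theorem coeff_linearCombination_monomial (x : ℕ →₀ ℂ) (k : ℕ) :
    (Finsupp.linearCombination ℂ (monomial W) x).coeff k = x k := by
  simp [coeff_linearCombination, coeff_monomial]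
  exact fun h => h.symm

theorem norm_sq_linearCombination_monomial (x : ℕ →₀ ℂ) :
    ‖Finsupp.linearCombination ℂ (monomial W) x‖ ^ 2 =
      ∑ n ∈ x.support, W.beta n ^ 2 * ‖x n‖ ^ 2 := by
  rw [norm_sq, tsum_eq_sum (s := x.support)]
  · simp only [coeff_linearCombination_monomial]
  · intro k hk
    simp [coeff_linearCombination_monomial, Finsupp.notMem_support_iff.1 hk]

theorem hasSum_monomial (f : WeightedHardy W) :
    HasSum (fun n => f.coeff n • monomial W n) f := by
  have h := lp.hasSum_single (p := 2) (by norm_num) (isometryEll2 f)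
  have h2 := h.mapL ((isometryEll2 (W := W)).symm.toContinuousLinearEquiv :
    lp (fun _ : ℕ => ℂ) 2 →L[ℂ] WeightedHardy W)
  simp only [ContinuousLinearEquiv.coe_coe, LinearIsometryEquiv.coe_toContinuousLinearEquiv,
    LinearIsometryEquiv.symm_apply_apply] at h2
  refine h2.congr_fun fun n => ?_
  rw [LinearIsometryEquiv.eq_symm_apply]
  ext k
  change (W.beta k : ℂ) * (f.coeff n • monomial W n).coeff k = _
  rw [coeff_smul, coeff_monomial]
  rcases eq_or_ne k n with rfl | hk
  · simp
    rfl
  · simp [hk]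

theorem denseRange_linearCombination_monomial :
    DenseRange (Finsupp.linearCombination ℂ (monomial W)) := by
  intro f
  refine mem_closure_of_tendsto (hasSum_monomial f) (.of_forall fun s => ?_)
  change _ ∈ LinearMap.range (Finsupp.linearCombination ℂ (monomial W))
  exact Submodule.sum_mem _ fun n _ => ⟨Finsupp.single n (f.coeff n), by simp⟩

/-- Evaluation at a point of the open unit disk is a bounded functional. -/
theorem exists_evalCLM (W : WeightSequence) {z : ℂ} (hz : ‖z‖ < 1) :
    ∃ Λ : WeightedHardy W →L[ℂ] ℂ, ∀ f, Λ f = f.eval z := by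
  obtain ⟨r, hzr, hr1⟩ := exists_between hz
  have hr0 : 0 < r := (norm_nonneg z).trans_lt hzr
  have hs := W.inv.summable_beta_sq_mul_pow (ρ := r ^ 2) (by positivity) (by nlinarith)
  -- The reproducing kernel at z.
  let κ : WeightedHardy W := ofCoeff (fun k => conj z ^ k / (W.beta k : ℂ) ^ 2) (by
    refine Summable.of_nonneg_of_le (fun k => by positivity) (fun k => ?_) hs
    have hb := W.beta_pos k
    rw [norm_div, norm_pow, norm_pow, Complex.norm_conj, Complex.norm_of_nonneg hb.le, W.beta_inv]
    have : ‖z‖ ^ k ≤ r ^ k := by gcongr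
    calc (‖z‖ ^ k / W.beta k ^ 2) ^ 2 * W.beta k ^ 2 ≤ (r ^ k / W.beta k ^ 2) ^ 2 * W.beta k ^ 2 := by
          gcongr
      _ = _ := by
          field_simp
          ring)
  refine ⟨innerSL ℂ κ, fun f => ?_⟩
  rw [innerSL_apply_apply, inner_def, eval]
  refine tsum_congr fun k => ?_
  have : (W.beta k : ℂ) ≠ 0 := by exact_mod_cast (W.beta_pos k).ne'
  simp only [κ, coeff_ofCoeff, map_div₀, map_pow, Complex.conj_conj, Complex.conj_ofReal,
    Complex.ofReal_pow]
  field_simp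

theorem eval_monomial (n : ℕ) (z : ℂ) : (monomial W n).eval z = z ^ n := by
  simp [eval, coeff_monomial]

/-- A matrix that satisfies the weighted bound defines a bounded operator. -/
theorem exists_operator {a : ℕ → ℕ → ℂ} {C : ℝ} (h : MatrixBound W.beta a C) (hC : 0 ≤ C) :
    ∃ T : WeightedHardy W →L[ℂ] WeightedHardy W, ∀ n m, (T (monomial W n)).coeff m = a m n := by
  let col : ℕ → WeightedHardy W := fun n => ofCoeff (fun m => a m n) (by
    refine summable_of_sum_le (c := C * (W.beta n ^ 2)) (fun _ => by positivity) fun t => ?_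
    simpa [mul_comm] using h {n} t fun _ => 1)
  -- The matrix bound controls the operator on polynomials, which are dense, so it extends
  -- continuously.
  have hbound : ∀ x : ℕ →₀ ℂ, ‖Finsupp.linearCombination ℂ col x‖ ≤
      √C * ‖Finsupp.linearCombination ℂ (monomial W) x‖ := by
    intro x
    refine (sq_le_sq₀ (by positivity) (by positivity)).1 ?_
    rw [mul_pow, Real.sq_sqrt hC, norm_sq_linearCombination_monomial, norm_sq]
    refine Real.tsum_le_of_sum_le (fun _ => by positivity) fun t => ?_
    simp only [coeff_linearCombination, mul_comm (x _)]
    exact h x.support t x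
  refine ⟨(Finsupp.linearCombination ℂ col).extendOfNorm (Finsupp.linearCombination ℂ (monomial W)),
    fun n m => ?_⟩
  have := LinearMap.extendOfNorm_eq denseRange_linearCombination_monomial ⟨_, hbound⟩
    (Finsupp.single n 1)
  simp only [Finsupp.linearCombination_single, one_smul] at this
  rw [this]
  rfl

end WeightedHardy

/-! ### Composition matrices on the unweighted Hardy space -/

theorem circleAverage_ofReal (f : ℂ → ℝ) :
    Real.circleAverage (fun z => (f z : ℂ)) 0 1 = (Real.circleAverage f 0 1 : ℝ) := by
  simp [Real.circleAverage, intervalIntegral.integral_ofReal]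

theorem circleAverage_conj_mul_self (F : ℂ → ℂ) :
    Real.circleAverage (fun z => conj (F z) * F z) 0 1 =
      (Real.circleAverage (fun z => ‖F z‖ ^ 2) 0 1 : ℝ) := by
  rw [← circleAverage_ofReal]
  simp only [Complex.conj_mul', Complex.ofReal_pow]

theorem sum_norm_sq_taylorCoeff_le {F : ℂ → ℂ}
    (hF : AnalyticOnNhd ℂ F (Metric.closedBall 0 1)) (t : Finset ℕ) :
    ∑ m ∈ t, ‖taylorCoeff F m‖ ^ 2 ≤ Real.circleAverage (fun z => ‖F z‖ ^ 2) 0 1 := by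
  have h := hasSum_conj_taylorCoeff_mul hF hF
  rw [circleAverage_conj_mul_self] at h
  simp only [Complex.conj_mul', ← Complex.ofReal_pow] at h
  exact sum_le_hasSum t (fun _ _ => by positivity) (Complex.hasSum_ofReal.1 h)

theorem taylorCoeff_sum {ι : Type*} (s : Finset ι) (x : ι → ℂ) {u : ι → ℂ → ℂ}
    (hu : ∀ i ∈ s, AnalyticAt ℂ (u i) 0) (m : ℕ) :
    taylorCoeff (fun z => ∑ i ∈ s, x i * u i z) m = ∑ i ∈ s, x i * taylorCoeff (u i) m := by
  simp only [taylorCoeff]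
  rw [iteratedDeriv_fun_sum fun i hi => (analyticAt_const.fun_mul (hu i hi)).contDiffAt,
    Finset.sum_div]
  refine Finset.sum_congr rfl fun i hi => ?_
  rw [iteratedDeriv_const_mul _ (hu i hi).contDiffAt, mul_div_assoc]

/-- Sesquilinear expansion over an orthogonal system of common squared norm κ. It is used for powers
of an inner function (κ = 1) and for the system attached to a disk automorphism. -/
theorem circleAverage_conj_sum_mul_sum {u : ℕ → ℂ → ℂ} {κ : ℂ}
    (hu : ∀ i, ContinuousOn (u i) (Metric.sphere 0 1))
    (h : ∀ i j, Real.circleAverage (fun z => conj (u i z) * u j z) 0 1 = if i = j then κ else 0)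
    (s : Finset ℕ) (x y : ℕ → ℂ) :
    Real.circleAverage (fun z => conj (∑ i ∈ s, x i * u i z) * ∑ j ∈ s, y j * u j z) 0 1 =
      κ * ∑ i ∈ s, conj (x i) * y i := by
  have hc : ∀ i j, ContinuousOn (fun z => conj (u i z) * u j z) (Metric.sphere 0 1) := fun i j =>
    (Complex.continuous_conj.comp_continuousOn (hu i)).mul (hu j)
  have hci : ∀ i j, CircleIntegrable (fun z => conj (x i) * y j * (conj (u i z) * u j z)) 0 1 :=
    fun i j => (continuousOn_const.mul (hc i j)).circleIntegrable zero_le_one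
  have hexp : (fun z => conj (∑ i ∈ s, x i * u i z) * ∑ j ∈ s, y j * u j z) =
      fun z => ∑ i ∈ s, ∑ j ∈ s, conj (x i) * y j * (conj (u i z) * u j z) := by
    funext z
    rw [map_sum, Finset.sum_mul_sum]
    refine Finset.sum_congr rfl fun i _ => Finset.sum_congr rfl fun j _ => ?_
    rw [map_mul]
    ring
  rw [hexp, Real.circleAverage_fun_sum fun i _ =>
    (continuousOn_finsetSum s fun j _ => continuousOn_const.fun_mul (hc i j)).circleIntegrable
      zero_le_one, Finset.mul_sum]
  refine Finset.sum_congr rfl fun i hi => ?_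
  rw [Real.circleAverage_fun_sum fun j _ => hci i j]
  have : ∀ j, Real.circleAverage (fun z => conj (x i) * y j * (conj (u i z) * u j z)) 0 1 =
      if i = j then κ * (conj (x i) * y i) else 0 := by
    intro j
    have := Real.circleAverage_fun_smul (a := conj (x i) * y j)
      (f := fun z => conj (u i z) * u j z) (c := 0) (R := 1)
    simp only [smul_eq_mul] at this
    rw [this, h]
    split_ifs with hij
    · subst hij; ring
    · ring
  simp only [this, Finset.sum_ite_eq, hi, if_true]

/-- The matrix of `f ↦ f ∘ φ` with respect to the monomials. -/
noncomputable def compMatrix (φ : ℂ → ℂ) (m n : ℕ) : ℂ := taylorCoeff (fun z => φ z ^ n) m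

theorem sum_compMatrix_mul {φ : ℂ → ℂ} (hφ : AnalyticOnNhd ℂ φ (Metric.closedBall 0 1))
    (s : Finset ℕ) (x : ℕ → ℂ) (m : ℕ) :
    ∑ n ∈ s, compMatrix φ m n * x n = taylorCoeff (fun z => ∑ n ∈ s, x n * φ z ^ n) m := by
  rw [taylorCoeff_sum s x fun n _ => (hφ 0 (by simp)).fun_pow n]
  exact Finset.sum_congr rfl fun n _ => mul_comm _ _

theorem analyticOnNhd_sum_pow {φ : ℂ → ℂ} {S : Set ℂ} (hφ : AnalyticOnNhd ℂ φ S)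
    (s : Finset ℕ) (x : ℕ → ℂ) : AnalyticOnNhd ℂ (fun z => ∑ n ∈ s, x n * φ z ^ n) S :=
  Finset.analyticOnNhd_fun_sum s fun n _ => analyticOnNhd_const.mul (hφ.pow n)

/-- By Parseval, mean squares of p∘φ on the circle control its Taylor coefficients. -/
theorem matrixBound_compMatrix {φ : ℂ → ℂ} (hφ : AnalyticOnNhd ℂ φ (Metric.closedBall 0 1)) {C : ℝ}
    (h : ∀ (s : Finset ℕ) (x : ℕ → ℂ),
      Real.circleAverage (fun z => ‖∑ n ∈ s, x n * φ z ^ n‖ ^ 2) 0 1 ≤ C * ∑ n ∈ s, ‖x n‖ ^ 2) :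
    MatrixBound (fun _ => 1) (compMatrix φ) C := by
  intro s t x
  simp only [one_pow, one_mul, sum_compMatrix_mul hφ]
  exact (sum_norm_sq_taylorCoeff_le (analyticOnNhd_sum_pow hφ s x) t).trans (h s x)

/-- **Littlewood's subordination principle** for polynomials. -/
theorem circleAverage_norm_sq_range_le {φ : ℂ → ℂ} (hφ : AnalyticOnNhd ℂ φ (Metric.closedBall 0 1))
    (h1 : ∀ z ∈ Metric.sphere (0 : ℂ) 1, ‖φ z‖ ≤ 1) (h0 : φ 0 = 0) (N : ℕ) (x : ℕ → ℂ) :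
    Real.circleAverage (fun z => ‖∑ n ∈ Finset.range N, x n * φ z ^ n‖ ^ 2) 0 1 ≤
      ∑ n ∈ Finset.range N, ‖x n‖ ^ 2 := by
  induction N generalizing x with
  | zero => simp [Real.circleAverage]
  | succ N ih =>
    -- Split off the constant term: p∘φ = x₀ + φG. The cross term has mean zero because φ(0) = 0,
    -- and |φG| ≤ |G| on the circle, so induction applies to G.
    set G : ℂ → ℂ := fun z => ∑ n ∈ Finset.range N, x (n + 1) * φ z ^ n with hG
    have hGa : AnalyticOnNhd ℂ G (Metric.closedBall 0 1) := analyticOnNhd_sum_pow hφ _ _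
    have hsub := Metric.sphere_subset_closedBall (x := (0 : ℂ)) (ε := 1)
    have hGc := hGa.continuousOn.mono hsub
    have hφc := hφ.continuousOn.mono hsub
    have hPa : AnalyticOnNhd ℂ (fun z => conj (x 0) * (φ z * G z)) (Metric.closedBall 0 1) :=
      analyticOnNhd_const.mul (hφ.mul hGa)
    have hPc := hPa.continuousOn.mono hsub
    have hexp : (fun z => ‖∑ n ∈ Finset.range (N + 1), x n * φ z ^ n‖ ^ 2) =
        fun z => (‖x 0‖ ^ 2 + ‖φ z * G z‖ ^ 2) + 2 * (conj (x 0) * (φ z * G z)).re := by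
      funext z
      have : ∑ n ∈ Finset.range (N + 1), x n * φ z ^ n = x 0 + φ z * G z := by
        rw [Finset.sum_range_succ', hG, Finset.mul_sum, pow_zero, mul_one, add_comm]
        congr 1
        exact Finset.sum_congr rfl fun n _ => by ring
      rw [this, ← Complex.normSq_eq_norm_sq, Complex.normSq_add, Complex.normSq_eq_norm_sq,
        Complex.normSq_eq_norm_sq, ← Complex.conj_re (x 0 * _)]
      simp
    have hre : Real.circleAverage (fun z => 2 * (conj (x 0) * (φ z * G z)).re) 0 1 = 0 := by
      have e1 := Complex.reCLM.circleAverage_comp_comm (hPc.circleIntegrable zero_le_one)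
      rw [hPa.circleAverage_eq, h0] at e1
      have e2 := Real.circleAverage_fun_smul (a := (2 : ℝ))
        (f := fun z => (conj (x 0) * (φ z * G z)).re) (c := 0) (R := 1)
      simp only [smul_eq_mul] at e2
      rw [e2]
      change Real.circleAverage (fun z => (conj (x 0) * (φ z * G z)).re) 0 1 = _ at e1
      rw [e1]
      simp
    have hc1 : ContinuousOn (fun z => ‖φ z * G z‖ ^ 2) (Metric.sphere 0 1) :=
      (hφc.mul hGc).norm.pow 2
    have hc2 : ContinuousOn (fun z => 2 * (conj (x 0) * (φ z * G z)).re) (Metric.sphere 0 1) :=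
      continuousOn_const.mul (Complex.continuous_re.comp_continuousOn hPc)
    rw [hexp, Real.circleAverage_fun_add ((continuousOn_const.fun_add hc1).circleIntegrable zero_le_one)
      (hc2.circleIntegrable zero_le_one), hre, add_zero,
      Real.circleAverage_fun_add (continuousOn_const.circleIntegrable zero_le_one)
        (hc1.circleIntegrable zero_le_one), Real.circleAverage_const, Finset.sum_range_succ',
      add_comm]
    gcongr
    refine le_trans (Real.circleAverage_mono (hc1.circleIntegrable zero_le_one)
      ((hGc.norm.pow 2).circleIntegrable zero_le_one) fun z hz => ?_) (ih fun n => x (n + 1))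
    rw [abs_one] at hz
    have := h1 z hz
    simp only [norm_mul, Pi.pow_apply]
    gcongr
    exact mul_le_of_le_one_left (norm_nonneg _) this

theorem matrixBound_one_of_apply_zero {φ : ℂ → ℂ}
    (hφ : AnalyticOnNhd ℂ φ (Metric.closedBall 0 1))
    (h1 : ∀ z ∈ Metric.sphere (0 : ℂ) 1, ‖φ z‖ ≤ 1) (h0 : φ 0 = 0) :
    MatrixBound (fun _ => 1) (compMatrix φ) 1 := by
  refine matrixBound_compMatrix hφ fun s x => ?_
  -- Coefficients on an arbitrary finite set are padded by zeros to an initial segment.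
  have hs : s ⊆ Finset.range (s.sup id + 1) := fun n hn =>
    Finset.mem_range.2 (Nat.lt_succ_of_le (Finset.le_sup (f := id) hn))
  have h := circleAverage_norm_sq_range_le hφ h1 h0 (s.sup id + 1)
    fun n => if n ∈ s then x n else 0
  have e1 : ∀ z, ∑ n ∈ Finset.range (s.sup id + 1), (if n ∈ s then x n else 0) * φ z ^ n =
      ∑ n ∈ s, x n * φ z ^ n := by
    intro z
    rw [← Finset.sum_subset hs fun n _ hn => by simp [hn]]
    exact Finset.sum_congr rfl fun n hn => by simp [hn]
  have e2 : ∑ n ∈ Finset.range (s.sup id + 1), ‖if n ∈ s then x n else 0‖ ^ 2 =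
      ∑ n ∈ s, ‖x n‖ ^ 2 := by
    rw [← Finset.sum_subset hs fun n _ hn => by simp [hn]]
    exact Finset.sum_congr rfl fun n hn => by simp [hn]
  simp only [e1, e2] at h
  linarith

/-! ### Disk automorphisms -/

/-- The disk automorphism that sends `a` to `0`. -/
noncomputable def moebius (a z : ℂ) : ℂ := (z - a) / (1 - conj a * z)

theorem moebius_denom_ne_zero {a z : ℂ} (ha : ‖a‖ < 1) (hz : ‖z‖ ≤ 1) : 1 - conj a * z ≠ 0 := by
  intro h
  have : ‖conj a * z‖ = 1 := by rw [← sub_eq_zero.1 h, norm_one]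
  rw [norm_mul, Complex.norm_conj] at this
  nlinarith [norm_nonneg a, norm_nonneg z]

theorem analyticOnNhd_moebius {a : ℂ} (ha : ‖a‖ < 1) :
    AnalyticOnNhd ℂ (moebius a) (Metric.closedBall 0 1) := fun z hz => by
  have := moebius_denom_ne_zero ha (by simpa using hz)
  unfold moebius
  fun_prop (disch := assumption)

theorem one_sub_norm_moebius_sq {a z : ℂ} (h : 1 - conj a * z ≠ 0) :
    1 - ‖moebius a z‖ ^ 2 = (1 - ‖a‖ ^ 2) * (1 - ‖z‖ ^ 2) / ‖1 - conj a * z‖ ^ 2 := by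
  have h' : ‖1 - conj a * z‖ ^ 2 ≠ 0 := by positivity
  rw [moebius, norm_div, div_pow, eq_div_iff h', sub_mul, div_mul_cancel₀ _ h']
  simp only [← Complex.normSq_eq_norm_sq, Complex.normSq_apply, Complex.sub_re, Complex.sub_im,
    Complex.mul_re, Complex.mul_im, Complex.conj_re, Complex.conj_im, Complex.one_re,
    Complex.one_im]
  ring

theorem norm_moebius_eq_one {a z : ℂ} (ha : ‖a‖ < 1) (hz : ‖z‖ = 1) : ‖moebius a z‖ = 1 := by
  have h := one_sub_norm_moebius_sq (moebius_denom_ne_zero ha hz.le)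
  rw [hz] at h
  have : ‖moebius a z‖ ^ 2 = 1 := by linarith [h.trans (by simp : _ = (0 : ℝ))]
  exact (pow_eq_one_iff_of_nonneg (norm_nonneg _) two_ne_zero).1 this

theorem norm_moebius_lt_one {a z : ℂ} (ha : ‖a‖ < 1) (hz : ‖z‖ < 1) : ‖moebius a z‖ < 1 := by
  have h0 := moebius_denom_ne_zero ha hz.le
  have h := one_sub_norm_moebius_sq h0
  have h1 : 0 < (1 - ‖a‖ ^ 2) * (1 - ‖z‖ ^ 2) / ‖1 - conj a * z‖ ^ 2 := by
    have : 0 < 1 - ‖a‖ ^ 2 := by nlinarith [norm_nonneg a]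
    have : 0 < 1 - ‖z‖ ^ 2 := by nlinarith [norm_nonneg z]
    positivity
  exact (sq_lt_one_iff₀ (norm_nonneg _)).1 (by linarith)

theorem moebius_self (a : ℂ) : moebius a a = 0 := by simp [moebius]

theorem moebius_neg_moebius {a z : ℂ} (ha : ‖a‖ < 1) (hz : ‖z‖ ≤ 1) :
    moebius (-a) (moebius a z) = z := by
  have h1 := moebius_denom_ne_zero ha hz
  have h2 : (1 : ℂ) - conj a * a ≠ 0 := moebius_denom_ne_zero ha ha.le
  have h3 : 1 - conj (-a) * ((z - a) / (1 - conj a * z)) = (1 - conj a * a) / (1 - conj a * z) := by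
    rw [map_neg]
    field_simp
    ring
  have h4 : (z - a) / (1 - conj a * z) - -a = z * (1 - conj a * a) / (1 - conj a * z) := by
    rw [sub_neg_eq_add, div_add' _ _ _ h1]
    ring
  rw [moebius, moebius, h3, h4, div_div_div_cancel_right₀ h1, mul_div_cancel_right₀ _ h2]

/-- With the Szegő kernel k = 1/(1 - āz), the functions k·τⁿ (τ = `moebius a`) are orthogonal of
squared norm 1/(1 - |a|²). Since |1 - āz| ≤ 2 on the circle, 1 ≤ 4|k|² there, so inserting k costs
only a factor 4. -/
theorem circleAverage_norm_sq_moebius_le {a : ℂ} (ha : ‖a‖ < 1) (s : Finset ℕ) (x : ℕ → ℂ) :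
    Real.circleAverage (fun z => ‖∑ n ∈ s, x n * moebius a z ^ n‖ ^ 2) 0 1 ≤
      4 / (1 - ‖a‖ ^ 2) * ∑ n ∈ s, ‖x n‖ ^ 2 := by
  have hsub := Metric.sphere_subset_closedBall (x := (0 : ℂ)) (ε := 1)
  set k : ℂ → ℂ := fun z => (1 - conj a * z)⁻¹ with hk
  have hd : ∀ z ∈ Metric.closedBall (0 : ℂ) 1, 1 - conj a * z ≠ 0 := fun z hz =>
    moebius_denom_ne_zero ha (by simpa using hz)
  have hka : AnalyticOnNhd ℂ k (Metric.closedBall 0 1) := fun z hz => by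
    have := hd z hz
    simp only [hk]
    fun_prop (disch := assumption)
  have hτ := analyticOnNhd_moebius ha
  -- On the circle the conjugate of k equals z/(z - a), so the average is Cauchy's formula for kg at
  -- a.
  have hkernel : ∀ g : ℂ → ℂ, AnalyticOnNhd ℂ g (Metric.closedBall 0 1) →
      Real.circleAverage (fun z => conj (k z) * (k z * g z)) 0 1 = g a / (1 - ‖a‖ ^ 2 : ℝ) := by
    intro g hg
    have hkg := (hka.mul hg).differentiableOn.diffContOnCl_ball (c := 0) (R := |(1 : ℝ)|)
      (by rw [abs_one])
    have e := hkg.circleAverage_smul_div (w := a) (by simpa using ha)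
    have e2 : k a * g a = g a / (1 - ‖a‖ ^ 2 : ℝ) := by
      simp only [hk, Complex.conj_mul']
      push_cast
      rw [div_eq_mul_inv, mul_comm]
    rw [← e2, ← e]
    refine Real.circleAverage_congr_sphere fun z hz => ?_
    rw [abs_one, mem_sphere_zero_iff_norm] at hz
    have hza : z - a ≠ 0 := by
      intro h
      rw [sub_eq_zero.1 h] at hz
      linarith
    have hz1 := conj_mul_self_of_norm_eq_one hz
    have hz0 : z ≠ 0 := by rintro rfl; simp at hz
    have hcz : conj z = z⁻¹ := eq_inv_of_mul_eq_one_left hz1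
    simp only [hk, smul_eq_mul, map_inv₀, map_sub, map_mul, map_one,
      Complex.conj_conj, hcz, sub_zero]
    congr 1
    have : 1 - a * z⁻¹ = (z - a) / z := by field_simp
    rw [this, inv_div]
  have horth : ∀ i j, Real.circleAverage
      (fun z => conj (k z * moebius a z ^ i) * (k z * moebius a z ^ j)) 0 1 =
        if i = j then ((1 - ‖a‖ ^ 2 : ℝ) : ℂ)⁻¹ else 0 := by
    have key : ∀ i d, Real.circleAverage
        (fun z => conj (k z * moebius a z ^ i) * (k z * moebius a z ^ (i + d))) 0 1 =
          if d = 0 then ((1 - ‖a‖ ^ 2 : ℝ) : ℂ)⁻¹ else 0 := by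
      intro i d
      have := hkernel (fun z => moebius a z ^ d) (hτ.pow d)
      rw [moebius_self, zero_pow_eq, ite_div, zero_div, one_div] at this
      rw [← this]
      refine Real.circleAverage_congr_sphere fun z hz => ?_
      rw [abs_one, mem_sphere_zero_iff_norm] at hz
      have h1 : conj (moebius a z ^ i) * moebius a z ^ i = 1 := by
        rw [map_pow, ← mul_pow, conj_mul_self_of_norm_eq_one (norm_moebius_eq_one ha hz), one_pow]
      simp only [map_mul, pow_add]
      linear_combination (conj (k z) * k z * moebius a z ^ d) * h1
    intro i j
    rcases le_total i j with h | h
    · obtain ⟨d, rfl⟩ := Nat.exists_eq_add_of_le h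
      rw [key]; simp
    · obtain ⟨d, rfl⟩ := Nat.exists_eq_add_of_le h
      have := key j d
      apply_fun conj at this
      rw [← circleAverage_conj] at this
      simp only [map_mul, Complex.conj_conj] at this
      simp only [map_mul, mul_comm (conj _ * conj _)]
      rw [this, apply_ite conj, map_inv₀, Complex.conj_ofReal, map_zero]
      simp
  have hsum := circleAverage_conj_sum_mul_sum (u := fun n z => k z * moebius a z ^ n)
    (fun n => ((hka.mul (hτ.pow n)).continuousOn.mono hsub)) horth s x x
  rw [circleAverage_conj_mul_self] at hsum
  simp only [Complex.conj_mul', ← Complex.ofReal_pow, ← Complex.ofReal_sum, ← Complex.ofReal_inv,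
    ← Complex.ofReal_mul] at hsum
  have hsum' := Complex.ofReal_injective hsum
  have hcF := (analyticOnNhd_sum_pow hτ s x).continuousOn.mono hsub
  have hcK := hka.continuousOn.mono hsub
  calc Real.circleAverage (fun z => ‖∑ n ∈ s, x n * moebius a z ^ n‖ ^ 2) 0 1
      ≤ Real.circleAverage (fun z => (4 : ℝ) • ‖∑ n ∈ s, x n * (k z * moebius a z ^ n)‖ ^ 2) 0 1 := by
        have hrw : ∀ z, ∑ n ∈ s, x n * (k z * moebius a z ^ n) =
            k z * ∑ n ∈ s, x n * moebius a z ^ n := fun z => by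
          rw [Finset.mul_sum]
          exact Finset.sum_congr rfl fun n _ => by ring
        simp only [hrw]
        refine Real.circleAverage_mono ((hcF.norm.pow 2).circleIntegrable zero_le_one)
          (((hcK.mul hcF).norm.pow 2).const_smul (4 : ℝ) |>.circleIntegrable zero_le_one)
          fun z hz => ?_
        rw [abs_one] at hz
        have hz' : ‖z‖ = 1 := by simpa using hz
        have h0 := hd z (hsub hz)
        have h2 : ‖1 - conj a * z‖ ≤ 2 := by
          refine (norm_sub_le _ _).trans ?_
          rw [norm_one, norm_mul, Complex.norm_conj, hz']
          linarith
        have hp : 0 < ‖1 - conj a * z‖ := norm_pos_iff.2 h0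
        have h3 : 1 ≤ 4 * ‖k z‖ ^ 2 := by
          simp only [hk, norm_inv]
          rw [inv_pow, ← div_eq_mul_inv, le_div_iff₀ (by positivity)]
          nlinarith
        simp only [norm_mul, mul_pow, smul_eq_mul]
        rw [← mul_assoc]
        exact le_mul_of_one_le_left (by positivity) h3
    _ = _ := by
        rw [Real.circleAverage_fun_smul, hsum', smul_eq_mul, div_eq_mul_inv, mul_assoc]

theorem matrixBound_one_moebius {a : ℂ} (ha : ‖a‖ < 1) :
    MatrixBound (fun _ => 1) (compMatrix (moebius a)) (4 / (1 - ‖a‖ ^ 2)) :=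
  matrixBound_compMatrix (analyticOnNhd_moebius ha) (circleAverage_norm_sq_moebius_le ha)

/-! ### Boundedness of composition operators -/

/-- Analytic self-maps of the closed unit disk that map the open disk into itself. -/
structure IsDiskMap (φ : ℂ → ℂ) : Prop where
  analytic : AnalyticOnNhd ℂ φ (Metric.closedBall 0 1)
  mapsTo : MapsTo φ (Metric.closedBall 0 1) (Metric.closedBall 0 1)
  norm_lt_one : ∀ z, ‖z‖ < 1 → ‖φ z‖ < 1

theorem IsDiskMap.comp {ψ φ : ℂ → ℂ} (hψ : IsDiskMap ψ) (hφ : IsDiskMap φ) :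
    IsDiskMap (ψ ∘ φ) where
  analytic := hψ.analytic.comp hφ.analytic hφ.mapsTo
  mapsTo := hψ.mapsTo.comp hφ.mapsTo
  norm_lt_one z hz := hψ.norm_lt_one _ (hφ.norm_lt_one z hz)

theorem isDiskMap_moebius {a : ℂ} (ha : ‖a‖ < 1) : IsDiskMap (moebius a) where
  analytic := analyticOnNhd_moebius ha
  mapsTo z hz := by
    rw [mem_closedBall_zero_iff] at hz ⊢
    rcases hz.lt_or_eq with h | h
    · exact (norm_moebius_lt_one ha h).le
    · exact (norm_moebius_eq_one ha h).le
  norm_lt_one _ hz := norm_moebius_lt_one ha hz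

/-- The entries of a composition matrix are geometrically small away from the diagonal. -/
theorem IsDiskMap.compMatrix_le {φ : ℂ → ℂ} (hφ : IsDiskMap φ) :
    ∃ (L : ℕ) (ρ : ℝ), 2 ≤ L ∧ 0 < ρ ∧ ρ < 1 ∧
      ∀ m n, L * n < m ∨ L * m < n → ‖compMatrix φ m n‖ ≤ ρ ^ (m + n) := by
  obtain ⟨R, hR, hd⟩ := exists_differentiableOn_closedBall hφ.analytic
  obtain ⟨M, hM⟩ := (isCompact_sphere (0 : ℂ) R).exists_bound_of_continuousOn
    (hd.continuousOn.mono Metric.sphere_subset_closedBall)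
  -- T = R^{1/4}. For m ≥ L₁n, Cauchy gives Mⁿ/R^m ≤ T^{2m}/T^{4m} = T^{-2m}: half of the decay
  -- absorbs Mⁿ, the rest beats T^{-(m+n)} since n ≤ m.
  set T := √(√R) with hT
  have hT1 : 1 < T := by
    rw [hT, Real.lt_sqrt zero_le_one, one_pow, Real.lt_sqrt zero_le_one, one_pow]
    exact hR
  have hT4 : T ^ 4 = R := by
    rw [show 4 = 2 * 2 from rfl, pow_mul, Real.sq_sqrt (Real.sqrt_nonneg _), Real.sq_sqrt (by linarith)]
  obtain ⟨L₁, hL₁⟩ := pow_unbounded_of_one_lt M (one_lt_pow₀ hT1 two_ne_zero)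
  have hsph : ∀ z ∈ Metric.sphere (0 : ℂ) (1 / 2), ‖z‖ < 1 := fun z hz => by
    rw [mem_sphere_zero_iff_norm.1 hz]; norm_num
  obtain ⟨z₀, hz₀, hmax⟩ := (isCompact_sphere (0 : ℂ) (1 / 2)).exists_isMaxOn
    (NormedSpace.sphere_nonempty.2 (by norm_num)) (f := fun z => ‖φ z‖)
    ((hφ.analytic.continuousOn.mono fun z hz => by
      simpa using (hsph z hz).le).norm)
  obtain ⟨q, hq, hq1⟩ := exists_between (hφ.norm_lt_one z₀ (hsph z₀ hz₀))
  have hq0 : 0 < q := (norm_nonneg _).trans_lt hq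
  -- The same device with Q = q^{1/4}: on |z| = 1/2 Cauchy gives qⁿ2^m, and L₂ is chosen so that
  -- half of the decay of qⁿ absorbs 2^m when n ≥ L₂m.
  set Q := √(√q) with hQ
  have hQ0 : 0 < Q := by positivity
  have hQ1 : Q < 1 := by
    rw [hQ, Real.sqrt_lt' one_pos, one_pow, Real.sqrt_lt' one_pos, one_pow]
    exact hq1
  have hQ4 : Q ^ 4 = q := by
    rw [show 4 = 2 * 2 from rfl, pow_mul, Real.sq_sqrt (Real.sqrt_nonneg _), Real.sq_sqrt hq0.le]
  obtain ⟨L₂, hL₂⟩ := exists_pow_lt_of_lt_one (show (0 : ℝ) < 1 / 2 by norm_num)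
    (show Q ^ 2 < 1 by nlinarith)
  refine ⟨L₁ + L₂ + 2, max Q T⁻¹, by omega, lt_max_of_lt_left hQ0,
    max_lt hQ1 (inv_lt_one_of_one_lt₀ hT1), fun m n hmn => ?_⟩
  have hT0 : 0 < T := by linarith
  rcases hmn with hmn | hmn
  · have h1 : L₁ * n ≤ m := by nlinarith
    have h2 : n ≤ m := by nlinarith
    have hb : ‖compMatrix φ m n‖ ≤ T ^ (2 * m) / R ^ m := by
      refine norm_taylorCoeff_le (by linarith) (hd.fun_pow n) (fun z hz => ?_) m
      rw [norm_pow]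
      calc ‖φ z‖ ^ n ≤ ((T ^ 2) ^ L₁) ^ n := by
            gcongr
            exact (hM z hz).trans hL₁.le
        _ = T ^ (2 * (L₁ * n)) := by rw [← pow_mul, ← pow_mul]
        _ ≤ _ := pow_le_pow_right₀ hT1.le (by omega)
    calc ‖compMatrix φ m n‖ ≤ T ^ (2 * m) / R ^ m := hb
      _ = T⁻¹ ^ (2 * m) := by
          rw [← hT4, ← pow_mul, inv_pow, show 4 * m = 2 * m + 2 * m by ring, pow_add]
          field_simp
      _ ≤ T⁻¹ ^ (m + n) := pow_le_pow_of_le_one (by positivity)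
          (inv_le_one_of_one_le₀ hT1.le) (by omega)
      _ ≤ _ := by
          gcongr
          exact le_max_right _ _
  · have h1 : L₂ * m ≤ n := by nlinarith
    have h2 : m ≤ n := by nlinarith
    have hb : ‖compMatrix φ m n‖ ≤ q ^ n / (1 / 2) ^ m := by
      refine norm_taylorCoeff_le (by norm_num) ((hφ.analytic.differentiableOn.mono
        (Metric.closedBall_subset_closedBall (by norm_num))).fun_pow n) (fun z hz => ?_) m
      rw [norm_pow]
      have : ‖φ z‖ ≤ ‖φ z₀‖ := hmax hz
      gcongr
      linarith
    have h3 : Q ^ (2 * n) ≤ (1 / 2 : ℝ) ^ m := by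
      calc Q ^ (2 * n) ≤ Q ^ (2 * (L₂ * m)) := pow_le_pow_of_le_one hQ0.le hQ1.le (by omega)
        _ = ((Q ^ 2) ^ L₂) ^ m := by rw [← pow_mul, ← pow_mul]
        _ ≤ _ := by gcongr
    calc ‖compMatrix φ m n‖ ≤ q ^ n / (1 / 2) ^ m := hb
      _ ≤ q ^ n / Q ^ (2 * n) := by gcongr
      _ = Q ^ (2 * n) := by
          rw [← hQ4, ← pow_mul, show 4 * n = 2 * n + 2 * n by ring, pow_add]
          field_simp
      _ ≤ Q ^ (m + n) := pow_le_pow_of_le_one hQ0.le hQ1.le (by omega)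
      _ ≤ _ := by
          gcongr
          exact le_max_left _ _

theorem IsDiskMap.matrixBound_weighted {φ : ℂ → ℂ} (hφ : IsDiskMap φ) {C : ℝ} (hC : 0 ≤ C)
    (h : MatrixBound (fun _ => 1) (compMatrix φ) C) {W : WeightSequence}
    (hW : W.PolynomialGrowth) : ∃ C', 0 ≤ C' ∧ MatrixBound W.beta (compMatrix φ) C' := by
  obtain ⟨L, ρ, hL, h0, h1, hfar⟩ := hφ.compMatrix_le
  exact h.weighted hW hC hL h0 h1 hfar

theorem IsDiskMap.matrixBound_one {φ : ℂ → ℂ} (hφ : IsDiskMap φ) (h0 : φ 0 = 0) :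
    MatrixBound (fun _ => 1) (compMatrix φ) 1 :=
  matrixBound_one_of_apply_zero hφ.analytic (fun z hz => by
    simpa using hφ.mapsTo (Metric.sphere_subset_closedBall hz)) h0

namespace WeightedHardy

variable {W : WeightSequence}

theorem eval_eq_of_coeff_eq_taylorCoeff {f : WeightedHardy W} {F : ℂ → ℂ}
    (hF : AnalyticOnNhd ℂ F (Metric.closedBall 0 1)) (h : ∀ n, f.coeff n = taylorCoeff F n) {z : ℂ}
    (hz : ‖z‖ < 1) : f.eval z = F z := by
  simp only [eval, h]
  exact (hasSum_taylorCoeff hF (by simpa using hz.le)).tsum_eq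

/-- Both sides are continuous in f because point evaluations are, so agreement on monomials
suffices. -/
theorem isCompositionOperator_of_coeff {φ : ℂ → ℂ} (hφ : IsDiskMap φ)
    {T : WeightedHardy W →L[ℂ] WeightedHardy W}
    (hT : ∀ n m, (T (monomial W n)).coeff m = compMatrix φ m n) : IsCompositionOperator φ T := by
  intro f z hz
  obtain ⟨Λ, hΛ⟩ := exists_evalCLM W hz
  obtain ⟨Λ', hΛ'⟩ := exists_evalCLM W (hφ.norm_lt_one z hz)
  rw [← hΛ, ← hΛ']
  have h1 := (hasSum_monomial f).mapL (Λ ∘L T)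
  refine h1.unique (((hasSum_monomial f).mapL Λ').congr_fun fun n => ?_)
  rw [map_smul, map_smul, ContinuousLinearMap.comp_apply, hΛ, hΛ', eval_monomial,
    eval_eq_of_coeff_eq_taylorCoeff (hφ.analytic.fun_pow n) (hT n) hz]

end WeightedHardy

open WeightedHardy

theorem IsCompositionOperator.comp {W : WeightSequence} {ψ φ : ℂ → ℂ} (hφ : IsDiskMap φ)
    {S T : WeightedHardy W →L[ℂ] WeightedHardy W} (hS : IsCompositionOperator ψ S)
    (hT : IsCompositionOperator φ T) : IsCompositionOperator (ψ ∘ φ) (T ∘L S) := fun f z hz => by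
  rw [ContinuousLinearMap.comp_apply, hT _ z hz, hS _ _ (hφ.norm_lt_one z hz), Function.comp_apply]

theorem IsCompositionOperator.congr {W : WeightSequence} {ψ φ : ℂ → ℂ}
    {T : WeightedHardy W →L[ℂ] WeightedHardy W} (hT : IsCompositionOperator φ T)
    (h : ∀ z, ‖z‖ < 1 → φ z = ψ z) : IsCompositionOperator ψ T := fun f z hz => by
  rw [hT f z hz, h z hz]

theorem exists_isCompositionOperator_moebius {W : WeightSequence} (hW : W.PolynomialGrowth) {a : ℂ}
    (ha : ‖a‖ < 1) :
    ∃ T : WeightedHardy W →L[ℂ] WeightedHardy W, IsCompositionOperator (moebius a) T := by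
  have hφ := isDiskMap_moebius ha
  have : 0 < 1 - ‖a‖ ^ 2 := by nlinarith [norm_nonneg a]
  obtain ⟨C, hC, h⟩ := hφ.matrixBound_weighted (by positivity) (matrixBound_one_moebius ha) hW
  obtain ⟨T, hT⟩ := exists_operator h hC
  exact ⟨T, isCompositionOperator_of_coeff hφ hT⟩

theorem moebius_neg_comp_moebius_comp {φ : ℂ → ℂ} (hφ : IsDiskMap φ) {z : ℂ} (hz : ‖z‖ < 1) :
    (moebius (-φ 0) ∘ (moebius (φ 0) ∘ φ)) z = φ z :=
  moebius_neg_moebius (hφ.norm_lt_one 0 (by simp)) (hφ.norm_lt_one z hz).le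

/-- Composition operators are bounded on weighted Hardy spaces of polynomial growth. -/
theorem IsDiskMap.exists_isCompositionOperator {W : WeightSequence} (hW : W.PolynomialGrowth)
    {φ : ℂ → ℂ} (hφ : IsDiskMap φ) :
    ∃ T : WeightedHardy W →L[ℂ] WeightedHardy W, IsCompositionOperator φ T := by
  have ha : ‖φ 0‖ < 1 := hφ.norm_lt_one 0 (by simp)
  -- Moving φ(0) to 0 makes Littlewood's principle available; the inverse automorphism undoes the
  -- move.
  have hψ := (isDiskMap_moebius ha).comp hφ
  obtain ⟨C, hC, h⟩ := hψ.matrixBound_weighted zero_le_one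
    (hψ.matrixBound_one (moebius_self _)) hW
  obtain ⟨T, hT⟩ := exists_operator h hC
  obtain ⟨S, hS⟩ := exists_isCompositionOperator_moebius hW (a := -φ 0) (by simpa using ha)
  exact ⟨T ∘L S, (hS.comp hψ (isCompositionOperator_of_coeff hψ hT)).congr fun z hz =>
    moebius_neg_comp_moebius_comp hφ hz⟩

/-! ### Lower bounds for inner symbols -/

/-- Composition with an inner function that fixes `0` is bounded below. -/
theorem exists_norm_le_of_apply_zero {W : WeightSequence} (hW : W.PolynomialGrowth)
    {φ : ℂ → ℂ} (hφ : IsDiskMap φ) (h1 : ∀ z ∈ Metric.sphere (0 : ℂ) 1, ‖φ z‖ = 1) (h0 : φ 0 = 0)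
    {T : WeightedHardy W →L[ℂ] WeightedHardy W} (hT : IsCompositionOperator φ T) :
    ∃ c : ℝ, ∀ f, ‖f‖ ≤ c * ‖T f‖ := by
  obtain ⟨C, hC, h⟩ := hφ.matrixBound_weighted zero_le_one (hφ.matrixBound_one h0) hW
  obtain ⟨C', hC', h'⟩ := hφ.matrixBound_weighted zero_le_one (hφ.matrixBound_one h0) hW.inv
  obtain ⟨T', hT'⟩ := exists_operator h hC
  obtain rfl := hT.unique (isCompositionOperator_of_coeff hφ hT')
  refine ⟨√C', fun f => ?_⟩
  refine denseRange_linearCombination_monomial.induction_on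
    (p := fun f => ‖f‖ ≤ √C' * ‖T f‖) f
    (isClosed_le (by fun_prop) (by fun_prop)) fun x => ?_
  set e := Finsupp.linearCombination ℂ (monomial W) x with he
  set X := ∑ n ∈ x.support, W.beta n ^ 2 * ‖x n‖ ^ 2 with hX
  have heX : ‖e‖ ^ 2 = X := norm_sq_linearCombination_monomial x
  set y : ℕ → ℂ := fun n => (W.beta n : ℂ) ^ 2 * x n with hy
  have hTe : ∀ m, (T e).coeff m = taylorCoeff (fun z => ∑ n ∈ x.support, x n * φ z ^ n) m := by
    intro m
    rw [he, Finsupp.linearCombination_apply, Finsupp.sum, map_sum]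
    simp only [map_smul]
    rw [coeff_sum, ← sum_compMatrix_mul hφ.analytic]
    exact Finset.sum_congr rfl fun n _ => by rw [hT', mul_comm]
  have hpars := hasSum_conj_taylorCoeff_mul (analyticOnNhd_sum_pow hφ.analytic x.support x)
    (analyticOnNhd_sum_pow hφ.analytic x.support y)
  rw [circleAverage_conj_sum_mul_sum (u := fun n z => φ z ^ n) (fun n =>
    (hφ.analytic.continuousOn.mono Metric.sphere_subset_closedBall).pow n)
    (circleAverage_conj_pow_mul_pow hφ.analytic h1 h0), one_mul] at hpars
  have hXy : ∑ n ∈ x.support, conj (x n) * y n = (X : ℂ) := by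
    rw [hX]
    push_cast
    refine Finset.sum_congr rfl fun n _ => ?_
    rw [← Complex.conj_mul']
    simp only [hy]
    ring
  rw [hXy] at hpars
  have hyX : ∑ n ∈ x.support, W.inv.beta n ^ 2 * ‖y n‖ ^ 2 = X := by
    refine Finset.sum_congr rfl fun n _ => ?_
    have hb := W.beta_pos n
    simp only [hy, norm_mul, norm_pow, Complex.norm_of_nonneg hb.le, W.beta_inv]
    field_simp
  have hX0 : 0 ≤ X := heX ▸ sq_nonneg _
  -- X is the H² pairing of e∘φ with g∘φ, where g has coefficients y. Cauchy–Schwarz with β on the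
  -- first and 1/β on the second, then the dual bound C', gives the estimate for partial sums, hence
  -- in the limit.
  have hXle : X ^ 2 ≤ ‖T e‖ ^ 2 * (C' * X) := by
    have hlim := (hpars.norm : Tendsto _ _ _).pow 2
    rw [Complex.norm_of_nonneg hX0] at hlim
    refine le_of_tendsto hlim (.of_forall fun t => ?_)
    have e1 : ∑ m ∈ t, (W.beta m * ‖(T e).coeff m‖) ^ 2 ≤ ‖T e‖ ^ 2 := by
      rw [norm_sq]
      simp only [mul_pow]
      refine Summable.sum_le_tsum t (fun _ _ => by positivity) ?_
      simpa only [mul_comm] using (T e).summable_coeff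
    have e2 : ∑ m ∈ t, (W.inv.beta m * ‖∑ n ∈ x.support, compMatrix φ m n * y n‖) ^ 2 ≤ C' * X := by
      rw [← hyX]
      simp only [mul_pow]
      exact h' x.support t y
    calc _ ≤ (∑ m ∈ t, (W.beta m * ‖(T e).coeff m‖) *
          (W.inv.beta m * ‖∑ n ∈ x.support, compMatrix φ m n * y n‖)) ^ 2 := by
          gcongr
          refine norm_sum_le_of_le _ fun m _ => ?_
          rw [norm_mul, RCLike.norm_conj, ← hTe, ← sum_compMatrix_mul hφ.analytic, W.beta_inv]
          have := (W.beta_pos m).ne'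
          field_simp
          rfl
      _ ≤ _ := Finset.sum_mul_sq_le_sq_mul_sq _ _ _
      _ ≤ _ := by gcongr
  refine (sq_le_sq₀ (norm_nonneg _) (by positivity)).1 ?_
  rw [mul_pow, Real.sq_sqrt hC', heX]
  rcases hX0.eq_or_lt with h | h
  · rw [← h]; positivity
  · refine le_of_mul_le_mul_right ?_ h
    linarith

/-- Composition with an inner function is bounded below. -/
theorem exists_norm_le_of_inner {W : WeightSequence} (hW : W.PolynomialGrowth)
    {φ : ℂ → ℂ} (hφ : IsDiskMap φ) (h1 : ∀ z ∈ Metric.sphere (0 : ℂ) 1, ‖φ z‖ = 1)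
    {T : WeightedHardy W →L[ℂ] WeightedHardy W} (hT : IsCompositionOperator φ T) :
    ∃ c : ℝ, ∀ f, ‖f‖ ≤ c * ‖T f‖ := by
  have ha : ‖φ 0‖ < 1 := hφ.norm_lt_one 0 (by simp)
  have ha' : ‖-φ 0‖ < 1 := by simpa using ha
  have hψ := (isDiskMap_moebius ha).comp hφ
  obtain ⟨A, hA⟩ := exists_isCompositionOperator_moebius hW ha
  obtain ⟨B, hB⟩ := exists_isCompositionOperator_moebius hW ha'
  obtain ⟨c, hc⟩ := exists_norm_le_of_apply_zero hW hψ
    (fun z hz => norm_moebius_eq_one ha (h1 z hz)) (moebius_self _) (hA.comp hφ hT)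
  -- T ∘ A is composition with an inner function fixing 0, hence bounded below; B is bounded below
  -- because A is a left inverse.
  have hTB : T = (T ∘L A) ∘L B := hT.unique (((hB.comp hψ (hA.comp hφ hT)).congr fun z hz =>
    moebius_neg_comp_moebius_comp hφ hz))
  have hAB : A ∘L B = ContinuousLinearMap.id ℂ _ := by
    have h := hB.comp (isDiskMap_moebius ha) hA
    refine h.unique fun f z hz => ?_
    rw [Function.comp_apply, moebius_neg_moebius ha hz.le]
    rfl
  refine ⟨‖A‖ * c, fun f => ?_⟩
  calc ‖f‖ = ‖A (B f)‖ := by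
        rw [← ContinuousLinearMap.comp_apply, hAB]; rfl
    _ ≤ ‖A‖ * ‖B f‖ := A.le_opNorm _
    _ ≤ ‖A‖ * (c * ‖(T ∘L A) (B f)‖) := by
        gcongr
        exact hc _
    _ = _ := by
        conv_rhs => rw [hTB]
        rw [mul_assoc]
        rfl

/-! ### Maximum principle, arcs and finite Blaschke products -/

theorem diffContOnCl_of_analyticOnNhd {F : ℂ → ℂ}
    (hF : AnalyticOnNhd ℂ F (Metric.closedBall 0 1)) : DiffContOnCl ℂ F (Metric.ball 0 1) :=
  hF.differentiableOn.diffContOnCl_ball subset_rfl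

/-- An analytic function whose modulus has an interior maximum on the closed disk is constant. -/
theorem eqOn_const_of_norm_le {F : ℂ → ℂ} (hF : AnalyticOnNhd ℂ F (Metric.closedBall 0 1)) {c : ℂ}
    (hc : ‖c‖ < 1) (h : ∀ z ∈ Metric.closedBall (0 : ℂ) 1, ‖F z‖ ≤ ‖F c‖) :
    ∀ z ∈ Metric.closedBall (0 : ℂ) 1, F z = F c := by
  rw [← closure_ball (0 : ℂ) one_ne_zero] at h ⊢
  exact Complex.eqOn_closure_of_isPreconnected_of_isMaxOn_norm
    (convex_ball (0 : ℂ) 1).isPreconnected Metric.isOpen_ball (diffContOnCl_of_analyticOnNhd hF)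
    (by simpa using hc) fun z hz => h z (subset_closure hz)

theorem isDiskMap_of_nonconstant {φ : ℂ → ℂ} (hφ : AnalyticOnNhd ℂ φ (Metric.closedBall 0 1))
    (hmaps : MapsTo φ (Metric.closedBall 0 1) (Metric.closedBall 0 1))
    (hnonconst : ¬ ∃ c : ℂ, ∀ z ∈ Metric.closedBall (0 : ℂ) 1, φ z = c) : IsDiskMap φ where
  analytic := hφ
  mapsTo := hmaps
  norm_lt_one z hz := by
    by_contra! h
    exact hnonconst ⟨φ z, eqOn_const_of_norm_le hφ hz fun w hw =>
      (mem_closedBall_zero_iff.1 (hmaps hw)).trans h⟩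

theorem norm_le_one_of_sphere {F : ℂ → ℂ} (hF : AnalyticOnNhd ℂ F (Metric.closedBall 0 1))
    (h1 : ∀ z ∈ Metric.sphere (0 : ℂ) 1, ‖F z‖ ≤ 1) {z : ℂ}
    (hz : z ∈ Metric.closedBall (0 : ℂ) 1) : ‖F z‖ ≤ 1 := by
  refine Complex.norm_le_of_forall_mem_frontier_norm_le Metric.isBounded_ball
    (diffContOnCl_of_analyticOnNhd hF) (fun w hw => h1 w ?_) (z := z) ?_
  · rwa [frontier_ball (0 : ℂ) one_ne_zero] at hw
  · rwa [closure_ball (0 : ℂ) one_ne_zero]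

theorem IsArc.not_countable {J : Set ℂ} (hJ : IsArc J) : ¬ J.Countable := by
  obtain ⟨a, b, hab, rfl⟩ := hJ
  intro h
  have h1 : (Icc a b).Countable :=
    (h.preimage_circleMap 0 one_ne_zero).mono (subset_preimage_image _ _)
  have h2 := Cardinal.mk_Icc_real hab
  have h3 := Cardinal.le_aleph0_iff_set_countable.2 h1
  rw [h2] at h3
  exact absurd h3 (not_le.2 Cardinal.aleph0_lt_continuum)

theorem isArc_sphere : IsArc (Metric.sphere (0 : ℂ) 1) := by
  refine ⟨0, 2 * Real.pi, Real.two_pi_pos, ?_⟩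
  refine Subset.antisymm ?_ (image_subset_iff.2 fun θ _ => circleMap_mem_sphere 0 zero_le_one θ)
  rw [← abs_one (α := ℝ), ← image_circleMap_Ioc, abs_one]
  exact image_mono Ioc_subset_Icc_self

/-- An analytic function on the closed disk that maps part of the circle onto an arc of the circle
is unimodular on the whole circle. -/
theorem norm_eq_one_of_isArc {φ : ℂ → ℂ} (hφ : AnalyticOnNhd ℂ φ (Metric.closedBall 0 1))
    {J : Set ℂ} (hJ : IsArc J) (hsub : J ⊆ φ '' Metric.sphere 0 1) :
    ∀ z ∈ Metric.sphere (0 : ℂ) 1, ‖φ z‖ = 1 := by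
  -- |φ(e^{iθ})|², written so that real analyticity is visible.
  set g : ℝ → ℝ := fun θ => (φ (circleMap 0 1 θ)).re ^ 2 + (φ (circleMap 0 1 θ)).im ^ 2 with hg
  have hgn : ∀ θ, g θ = ‖φ (circleMap 0 1 θ)‖ ^ 2 := fun θ => by
    rw [← Complex.normSq_eq_norm_sq, Complex.normSq_apply]; simp only [hg]; ring
  have hcirc : ∀ θ, AnalyticAt ℝ (circleMap 0 1) θ := fun θ => by
    unfold circleMap
    refine analyticAt_const.add (analyticAt_const.mul ?_)
    have h1 : AnalyticAt ℝ (fun x : ℝ => (x : ℂ) * Complex.I) θ :=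
      (Complex.ofRealCLM.analyticAt θ).mul analyticAt_const
    have h2 : AnalyticAt ℝ Complex.exp ((θ : ℂ) * Complex.I) := analyticAt_cexp.restrictScalars
    exact h2.comp (f := fun x : ℝ => (x : ℂ) * Complex.I) h1
  have hcl : ∀ θ : ℝ, circleMap 0 1 θ ∈ Metric.closedBall (0 : ℂ) 1 := fun θ =>
    Metric.sphere_subset_closedBall (circleMap_mem_sphere 0 zero_le_one θ)
  have hφc : ∀ θ : ℝ, AnalyticAt ℝ (fun θ => φ (circleMap 0 1 θ)) θ := fun θ =>
    ((hφ _ (hcl θ)).restrictScalars (𝕜 := ℝ)).comp (hcirc θ)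
  have hga : AnalyticOnNhd ℝ g univ := fun θ _ =>
    (((Complex.reCLM.analyticAt _).comp (hφc θ)).pow 2).add
      (((Complex.imCLM.analyticAt _).comp (hφc θ)).pow 2)
  set Z : Set ℝ := {θ ∈ Icc 0 (2 * Real.pi) | g θ = 1}
  -- J lies in the image of Z under θ ↦ φ(e^{iθ}), and an arc is uncountable.
  have hZ : Z.Infinite := by
    intro hfin
    refine hJ.not_countable ((hfin.image fun θ => φ (circleMap 0 1 θ)).countable.mono ?_)
    intro w hw
    obtain ⟨z, hz, rfl⟩ := hsub hw
    have hz' : z ∈ circleMap 0 1 '' Ioc 0 (2 * Real.pi) := by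
      rw [image_circleMap_Ioc, abs_one]; exact hz
    obtain ⟨θ, hθ, rfl⟩ := hz'
    refine ⟨θ, ⟨Ioc_subset_Icc_self hθ, ?_⟩, rfl⟩
    obtain ⟨a, b, -, rfl⟩ := hJ
    obtain ⟨t, -, ht⟩ := hw
    rw [hgn, ← ht]
    simp
  obtain ⟨θ₀, -, hacc⟩ := hZ.exists_accPt_of_subset_isCompact isCompact_Icc fun θ hθ => hθ.1
  have hfreq : ∃ᶠ θ in 𝓝[≠] θ₀, g θ = 1 :=
    (accPt_iff_frequently_nhdsNE.1 hacc).mono fun θ hθ => hθ.2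
  have hone := hga.eq_of_frequently_eq (g := fun _ => 1) analyticOnNhd_const hfreq
  intro z hz
  have hz' : z ∈ circleMap 0 1 '' Ioc 0 (2 * Real.pi) := by
    rw [image_circleMap_Ioc, abs_one]; exact hz
  obtain ⟨θ, -, rfl⟩ := hz'
  have := congrFun hone θ
  rw [hgn] at this
  exact (pow_eq_one_iff_of_nonneg (norm_nonneg _) two_ne_zero).1 this

/-- A zero in the disk can be divided out by a disk automorphism. -/
theorem exists_eq_moebius_mul {φ : ℂ → ℂ} (hφ : AnalyticOnNhd ℂ φ (Metric.closedBall 0 1)) {a : ℂ}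
    (ha : ‖a‖ < 1) (h0 : φ a = 0) :
    ∃ g : ℂ → ℂ, AnalyticOnNhd ℂ g (Metric.closedBall 0 1) ∧
      ∀ z ∈ Metric.closedBall (0 : ℂ) 1, φ z = moebius a z * g z := by
  have hU := isOpen_analyticAt ℂ φ
  have haU : {x | AnalyticAt ℂ φ x} ∈ 𝓝 a := hU.mem_nhds (hφ a (by simpa using ha.le))
  have hd : DifferentiableOn ℂ (dslope φ a) {x | AnalyticAt ℂ φ x} :=
    (Complex.differentiableOn_dslope haU).2 fun z hz => hz.differentiableAt.differentiableWithinAt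
  have hda := hd.analyticOnNhd hU
  refine ⟨fun z => (1 - conj a * z) * dslope φ a z, fun z hz => ?_, fun z hz => ?_⟩
  · have := hda z (hφ z hz)
    fun_prop
  · have h1 := moebius_denom_ne_zero ha (mem_closedBall_zero_iff.1 hz)
    have h2 := sub_smul_dslope φ a z
    rw [h0, sub_zero, smul_eq_mul] at h2
    rw [moebius, ← mul_assoc, div_mul_cancel₀ _ h1, h2]

theorem IsFiniteBlaschkeProduct.moebius_mul {φ g : ℂ → ℂ} {a : ℂ} (ha : ‖a‖ < 1)
    (hg : IsFiniteBlaschkeProduct g)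
    (h : ∀ z ∈ Metric.closedBall (0 : ℂ) 1, φ z = moebius a z * g z) :
    IsFiniteBlaschkeProduct φ := by
  obtain ⟨m, b, c, hc, hb, hgb⟩ := hg
  refine ⟨m + 1, Fin.cons a b, c, hc, fun j => ?_, fun z hz => ?_⟩
  · refine Fin.cases ?_ (fun i => ?_) j
    · simpa using ha
    · simpa using hb i
  · rw [h z hz, hgb z hz, Fin.prod_univ_succ]
    simp only [Fin.cons_zero, Fin.cons_succ, moebius]
    ring

/-- The maximum principle for 1/φ gives |φ(0)| ≥ 1, so |φ| attains its maximum at an interior point.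
-/
theorem eqOn_const_of_norm_eq_one_of_ne_zero {φ : ℂ → ℂ}
    (hφ : AnalyticOnNhd ℂ φ (Metric.closedBall 0 1))
    (h1 : ∀ z ∈ Metric.sphere (0 : ℂ) 1, ‖φ z‖ = 1)
    (h0 : ∀ z ∈ Metric.closedBall (0 : ℂ) 1, φ z ≠ 0) :
    ∀ z ∈ Metric.closedBall (0 : ℂ) 1, φ z = φ 0 := by
  refine eqOn_const_of_norm_le hφ (by simp) fun z hz => ?_
  have hinv := norm_le_one_of_sphere (F := φ⁻¹) (hφ.inv h0)
    (fun w hw => by simp [h1 w hw]) (z := 0) (by simp)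
  rw [Pi.inv_apply, norm_inv] at hinv
  have hpos : 0 < ‖φ 0‖ := norm_pos_iff.2 (h0 0 (by simp))
  exact (norm_le_one_of_sphere hφ (fun w hw => (h1 w hw).le) hz).trans
    ((inv_le_one₀ hpos).1 hinv)

/-- An analytic function on the closed disk that is unimodular on the circle is a finite Blaschke
product. -/
theorem isFiniteBlaschkeProduct_of_norm_eq_one {φ : ℂ → ℂ}
    (hφ : AnalyticOnNhd ℂ φ (Metric.closedBall 0 1))
    (h1 : ∀ z ∈ Metric.sphere (0 : ℂ) 1, ‖φ z‖ = 1) : IsFiniteBlaschkeProduct φ := by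
  have hball : ∀ z ∈ Metric.closedBall (0 : ℂ) 1, ‖z‖ ≠ 1 → ‖z‖ < 1 := fun z hz hne =>
    lt_of_le_of_ne (mem_closedBall_zero_iff.1 hz) hne
  obtain ⟨z₀, hz₀, hne⟩ : ∃ z₀ : ℂ, ‖z₀‖ < 1 ∧ φ z₀ ≠ 0 := by
    by_contra! h
    have hcl : EqOn φ 0 (Metric.closedBall 0 1) :=
      EqOn.of_subset_closure (s := Metric.ball 0 1) (fun z hz => h z (by simpa using hz))
        hφ.continuousOn continuousOn_const Metric.ball_subset_closedBall
        (closure_ball (0 : ℂ) one_ne_zero).ge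
    have h2 := h1 1 (by simp)
    rw [hcl (by simp)] at h2
    simp at h2
  set K : Set ℂ := Metric.closedBall 0 1 ∩ φ ⁻¹' {0}
  have hKc : IsCompact K := (isCompact_closedBall (0 : ℂ) 1).of_isClosed_subset
    (hφ.continuousOn.preimage_isClosed_of_isClosed Metric.isClosed_closedBall isClosed_singleton)
    inter_subset_left
  have hK : ∀ a ∈ K, ‖a‖ < 1 := fun a ha => hball a ha.1 fun h => by
    have h2 := h1 a (by simpa using h)
    rw [show φ a = 0 from ha.2] at h2
    simp at h2
  -- By compactness of the zero set, dividing out any zero shrinks the value at z₀ by a factor at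
  -- most q, uniformly.
  obtain ⟨q, hq0, hq1, hq⟩ : ∃ q : ℝ, 0 ≤ q ∧ q < 1 ∧ ∀ a ∈ K, ‖moebius a z₀‖ ≤ q := by
    rcases K.eq_empty_or_nonempty with he | hn
    · exact ⟨0, le_rfl, one_pos, by simp [he]⟩
    · have hc : ContinuousOn (fun a => ‖moebius a z₀‖) K := by
        refine ContinuousOn.norm (ContinuousOn.div (by fun_prop) (by fun_prop) fun a ha => ?_)
        exact moebius_denom_ne_zero (hK a ha) hz₀.le
      obtain ⟨a, ha, hmax⟩ := hKc.exists_isMaxOn hn hc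
      exact ⟨_, norm_nonneg _, norm_moebius_lt_one (hK a ha) hz₀, fun b hb => hmax hb⟩
  -- Induction on how often zeros can be divided out: each division replaces qⁿ⁺¹ < |ψ(z₀)| by qⁿ <
  -- |g(z₀)|, and |g(z₀)| ≤ 1 stops the process. Zeros of a quotient remain in K, so q never changes
  -- and multiplicities need no count.
  have key : ∀ (n : ℕ) (ψ : ℂ → ℂ), AnalyticOnNhd ℂ ψ (Metric.closedBall 0 1) →
      (∀ z ∈ Metric.sphere (0 : ℂ) 1, ‖ψ z‖ = 1) → Metric.closedBall 0 1 ∩ ψ ⁻¹' {0} ⊆ K →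
      q ^ n < ‖ψ z₀‖ → IsFiniteBlaschkeProduct ψ := by
    intro n
    induction n with
    | zero =>
      intro ψ hψ hψ1 _ hlt
      have := norm_le_one_of_sphere hψ (fun w hw => (hψ1 w hw).le) (z := z₀) (by simpa using hz₀.le)
      rw [pow_zero] at hlt
      linarith
    | succ n ih =>
      intro ψ hψ hψ1 hψK hlt
      by_cases hzero : ∃ a ∈ Metric.closedBall (0 : ℂ) 1, ψ a = 0
      · obtain ⟨a, ha, ha0⟩ := hzero
        have haK : a ∈ K := hψK ⟨ha, ha0⟩
        obtain ⟨g, hg, hψg⟩ := exists_eq_moebius_mul hψ (hK a haK) ha0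
        refine IsFiniteBlaschkeProduct.moebius_mul (hK a haK) (ih g hg ?_ ?_ ?_) hψg
        · intro z hz
          have h2 := hψ1 z hz
          rwa [hψg z (Metric.sphere_subset_closedBall hz), norm_mul,
            norm_moebius_eq_one (hK a haK) (by simpa using hz), one_mul] at h2
        · rintro z ⟨hz, hz0⟩
          refine hψK ⟨hz, ?_⟩
          rw [mem_preimage, mem_singleton_iff] at hz0 ⊢
          rw [hψg z hz, hz0, mul_zero]
        · rw [hψg z₀ (by simpa using hz₀.le), norm_mul, pow_succ'] at hlt
          by_contra! hle
          have := mul_le_mul (hq a haK) hle (norm_nonneg _) hq0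
          linarith
      · push Not at hzero
        refine ⟨0, Fin.elim0, ψ 0, ?_, fun j => j.elim0, fun z hz => ?_⟩
        · rw [← eqOn_const_of_norm_eq_one_of_ne_zero hψ hψ1 hzero 1 (by simp)]
          exact hψ1 1 (by simp)
        · simpa using eqOn_const_of_norm_eq_one_of_ne_zero hψ hψ1 hzero z hz
  obtain ⟨n, hn⟩ := exists_pow_lt_of_lt_one (norm_pos_iff.2 hne) hq1
  exact key n φ hφ h1 subset_rfl hn

theorem IsFiniteBlaschkeProduct.norm_eq_one {φ : ℂ → ℂ} (hφ : IsFiniteBlaschkeProduct φ) :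
    ∀ z ∈ Metric.sphere (0 : ℂ) 1, ‖φ z‖ = 1 := by
  obtain ⟨m, a, c, hc, ha, h⟩ := hφ
  intro z hz
  rw [h z (Metric.sphere_subset_closedBall hz), norm_mul, hc, one_mul, norm_prod]
  exact Finset.prod_eq_one fun j _ => norm_moebius_eq_one (ha j) (by simpa using hz)

/-! ### Necessity: injectivity and peak functions -/

namespace WeightedHardy

variable {W : WeightSequence}

theorem hasFPowerSeriesOnBall_eval (f : WeightedHardy W) :
    HasFPowerSeriesOnBall f.eval (FormalMultilinearSeries.ofScalars ℂ f.coeff) 0 1 where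
  r_le := by
    refine ENNReal.le_of_forall_nnreal_lt fun r hr => ?_
    refine FormalMultilinearSeries.le_radius_of_summable_norm _ ?_
    have hr1 : (r : ℝ) < 1 := by exact_mod_cast hr
    have h := (f.hasSum_eval (z := ((r : ℝ) : ℂ)) (by simpa using hr1)).summable.norm
    refine h.congr fun k => ?_
    rw [FormalMultilinearSeries.ofScalars_norm]
    simp
  r_pos := one_pos
  hasSum := fun {y} hy => by
    have hy' : ‖y‖ < 1 := by
      rw [Metric.mem_eball, edist_zero_right] at hy
      simpa [enorm_eq_nnnorm, ← NNReal.coe_lt_one] using hy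
    rw [zero_add]
    refine (f.hasSum_eval hy').congr_fun fun k => ?_
    simp [mul_comm]

theorem analyticOnNhd_eval (f : WeightedHardy W) :
    AnalyticOnNhd ℂ f.eval (Metric.ball 0 1) := by
  have := f.hasFPowerSeriesOnBall_eval.analyticOnNhd
  rwa [← ENNReal.coe_one, Metric.eball_coe, NNReal.coe_one] at this

/-- A function analytic on the closed disk, as an element of the weighted Hardy space. -/
noncomputable def ofAnalytic (W : WeightSequence) {F : ℂ → ℂ}
    (hF : AnalyticOnNhd ℂ F (Metric.closedBall 0 1)) : WeightedHardy W :=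
  ofCoeff (taylorCoeff F) (by
    obtain ⟨R, C, hR, h⟩ := norm_taylorCoeff_le_geometric hF
    have hR0 : 0 < R := by linarith
    have hs := W.summable_beta_sq_mul_pow (ρ := (R ^ 2)⁻¹) (by positivity)
      (inv_lt_one_of_one_lt₀ (one_lt_pow₀ hR two_ne_zero))
    refine Summable.of_nonneg_of_le (fun _ => by positivity) (fun k => ?_) (hs.mul_left (C ^ 2))
    calc ‖taylorCoeff F k‖ ^ 2 * W.beta k ^ 2 ≤ (C / R ^ k) ^ 2 * W.beta k ^ 2 := by
          gcongr
          exact h k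
      _ = _ := by rw [inv_pow, ← pow_mul, div_pow, ← pow_mul, mul_comm k 2]; ring)

theorem eval_ofAnalytic {F : ℂ → ℂ} (hF : AnalyticOnNhd ℂ F (Metric.closedBall 0 1)) {z : ℂ}
    (hz : ‖z‖ < 1) : (ofAnalytic W hF).eval z = F z :=
  eval_eq_of_coeff_eq_taylorCoeff hF (fun _ => rfl) hz

/-- Geometric decay beats the subexponential growth of β. S depends only on W and R, so a family
bounded on |z| = R is controlled uniformly through Cauchy's estimates. -/
theorem exists_norm_le_of_coeff_le (W : WeightSequence) {R : ℝ} (hR : 1 < R) :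
    ∃ S : ℝ, 0 ≤ S ∧ ∀ (f : WeightedHardy W) (C : ℝ), (∀ k, ‖f.coeff k‖ ≤ C / R ^ k) →
      ‖f‖ ≤ S * C := by
  have hR0 : 0 < R := by linarith
  have hs := W.summable_beta_sq_mul_pow (ρ := (R ^ 2)⁻¹) (by positivity)
    (inv_lt_one_of_one_lt₀ (one_lt_pow₀ hR two_ne_zero))
  refine ⟨√(∑' k, W.beta k ^ 2 * (R ^ 2)⁻¹ ^ k), Real.sqrt_nonneg _, fun f C h => ?_⟩
  have hC : 0 ≤ C := (norm_nonneg _).trans (by simpa using h 0)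
  refine (sq_le_sq₀ (norm_nonneg _) (by positivity)).1 ?_
  rw [mul_pow, Real.sq_sqrt (tsum_nonneg fun _ => by positivity), norm_sq, ← tsum_mul_right]
  refine Summable.tsum_le_tsum (fun k => ?_) (by simpa only [mul_comm] using f.summable_coeff)
    (hs.mul_right _)
  calc W.beta k ^ 2 * ‖f.coeff k‖ ^ 2 ≤ W.beta k ^ 2 * (C / R ^ k) ^ 2 := by
        gcongr
        exact h k
    _ = _ := by rw [inv_pow, ← pow_mul, div_pow, ← pow_mul, mul_comm k 2]; ring

end WeightedHardy

open WeightedHardy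

/-- By the open mapping theorem f vanishes near φ(0), and the identity theorem does the rest. -/
theorem IsCompositionOperator.injective {W : WeightSequence} {φ : ℂ → ℂ} (hφ : IsDiskMap φ)
    (hnonconst : ¬ ∃ c : ℂ, ∀ z ∈ Metric.closedBall (0 : ℂ) 1, φ z = c)
    {T : WeightedHardy W →L[ℂ] WeightedHardy W} (hT : IsCompositionOperator φ T) :
    Function.Injective T := by
  rw [injective_iff_map_eq_zero]
  intro f hf
  have h0 : (0 : ℂ) ∈ Metric.closedBall (0 : ℂ) 1 := by simp
  have hopen : 𝓝 (φ 0) ≤ map φ (𝓝 0) := by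
    refine ((hφ.analytic 0 h0).eventually_constant_or_nhds_le_map_nhds).resolve_left fun h => ?_
    exact hnonconst ⟨φ 0, hφ.analytic.eqOn_of_preconnected_of_eventuallyEq analyticOnNhd_const
      (convex_closedBall (0 : ℂ) 1).isPreconnected h0 h⟩
  have hzero : ∀ z : ℂ, ‖z‖ < 1 → (0 : WeightedHardy W).eval z = 0 := fun z _ => by simp [eval]
  have hev : f.eval =ᶠ[𝓝 (φ 0)] 0 := by
    refine hopen (mem_map.2 ?_)
    filter_upwards [Metric.ball_mem_nhds (0 : ℂ) one_pos] with z hz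
    have hz' : ‖z‖ < 1 := by simpa using hz
    change f.eval (φ z) = 0
    rw [← hT f z hz', hf, hzero z hz']
  refine eval_injective fun z hz => ?_
  rw [hzero z hz]
  exact f.analyticOnNhd_eval.eqOn_zero_of_preconnected_of_eventuallyEq_zero
    (convex_ball (0 : ℂ) 1).isPreconnected
    (by simpa using hφ.norm_lt_one 0 (by simp)) hev (by simpa using hz)

theorem norm_add_one_lt_two {u : ℂ} (hu : ‖u‖ ≤ 1) (h : u ≠ 1) : ‖1 + u‖ < 2 := by
  have h1 : ‖u‖ ^ 2 ≤ 1 := pow_le_one₀ (norm_nonneg _) hu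
  rw [← Complex.normSq_eq_norm_sq, Complex.normSq_apply] at h1
  have h2 : ‖1 + u‖ ^ 2 < 2 ^ 2 := by
    rw [← Complex.normSq_eq_norm_sq, Complex.normSq_apply]
    simp only [Complex.add_re, Complex.add_im, Complex.one_re, Complex.one_im, zero_add]
    have hre : u.re < 1 := by
      by_contra! hle
      refine h (Complex.ext ?_ ?_)
      · simp only [Complex.one_re]; nlinarith [mul_self_nonneg u.im]
      · simp only [Complex.one_im]
        exact mul_self_eq_zero.1 (by nlinarith [mul_self_nonneg u.im])
    nlinarith
  exact lt_of_pow_lt_pow_left₀ 2 (by norm_num) h2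

/-- If the image of `φ` misses a point of the circle, then peak functions at that point show that
composition with `φ` is not bounded below. -/
theorem sphere_subset_image_of_norm_le {W : WeightSequence} {φ : ℂ → ℂ} (hφ : IsDiskMap φ)
    {T : WeightedHardy W →L[ℂ] WeightedHardy W} (hT : IsCompositionOperator φ T) {c : ℝ}
    (hc0 : 0 ≤ c) (hc : ∀ f, ‖f‖ ≤ c * ‖T f‖) :
    Metric.sphere (0 : ℂ) 1 ⊆ φ '' Metric.closedBall 0 1 := by
  intro ξ hξ
  by_contra hnot
  have hξ1 : ‖ξ‖ = 1 := by simpa using hξ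
  -- Peak function: P(ξ) = 1 and |P| < 1 elsewhere on the closed disk, hence on the image of φ.
  set P : ℂ → ℂ := fun w => (1 + conj ξ * w) / 2 with hP
  have hPa : ∀ w, AnalyticAt ℂ P w := fun w => by simp only [hP]; fun_prop (disch := norm_num)
  have hPφc : ContinuousOn (fun z => P (φ z)) {z | AnalyticAt ℂ φ z} := fun z hz =>
    ((hPa (φ z)).continuousAt.comp hz.continuousAt).continuousWithinAt
  have hPlt : ∀ z ∈ Metric.closedBall (0 : ℂ) 1, ‖P (φ z)‖ < 1 := by
    intro z hz
    have h1 : ‖conj ξ * φ z‖ ≤ 1 := by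
      rw [norm_mul, Complex.norm_conj, hξ1, one_mul]
      exact mem_closedBall_zero_iff.1 (hφ.mapsTo hz)
    have h2 : conj ξ * φ z ≠ 1 := by
      intro h
      refine hnot ⟨z, hz, ?_⟩
      have h3 : ξ * conj ξ = 1 := by rw [mul_comm]; exact conj_mul_self_of_norm_eq_one hξ1
      calc φ z = (ξ * conj ξ) * φ z := by rw [h3, one_mul]
        _ = ξ := by rw [mul_assoc, h, mul_one]
    have := norm_add_one_lt_two h1 h2
    simp only [hP, norm_div, Complex.norm_ofNat]
    linarith
  obtain ⟨z₁, hz₁, hmax⟩ := (isCompact_closedBall (0 : ℂ) 1).exists_isMaxOn ⟨0, by simp⟩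
    (hPφc.mono fun z hz => hφ.analytic z hz).norm
  obtain ⟨q, hq, hq1⟩ := exists_between (hPlt z₁ hz₁)
  have hq0 : 0 < q := (norm_nonneg _).trans_lt hq
  -- The bound |P∘φ| < q persists on a larger disk, so Cauchy's estimates give ‖T(Pⁿ)‖ ≤ S qⁿ.
  obtain ⟨δ, hδ, hδU⟩ := (isCompact_closedBall (0 : ℂ) 1).exists_cthickening_subset_open
    (hPφc.isOpen_inter_preimage (isOpen_analyticAt ℂ φ) (Metric.isOpen_ball (x := 0) (ε := q)))
    (fun z hz => ⟨hφ.analytic z hz, by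
      simpa using (show ‖P (φ z)‖ ≤ ‖P (φ z₁)‖ from hmax hz).trans_lt hq⟩)
  rw [cthickening_closedBall hδ.le zero_le_one] at hδU
  have hR : 1 < δ + 1 := by linarith
  obtain ⟨S, hS, hSle⟩ := exists_norm_le_of_coeff_le W hR
  have hPn : ∀ n, AnalyticOnNhd ℂ (fun w => P w ^ n) (Metric.closedBall 0 1) := fun n w _ =>
    (hPa w).fun_pow n
  have hPφn : ∀ n, AnalyticOnNhd ℂ (fun z => P (φ z) ^ n) (Metric.closedBall 0 1) := fun n =>
    (hPn n).comp hφ.analytic hφ.mapsTo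
  have hTn : ∀ n, T (ofAnalytic W (hPn n)) = ofAnalytic W (hPφn n) := fun n =>
    eval_injective fun z hz => by
      rw [hT _ z hz, eval_ofAnalytic _ (hφ.norm_lt_one z hz), eval_ofAnalytic _ hz]
  have hTle : ∀ n, ‖T (ofAnalytic W (hPn n))‖ ≤ S * q ^ n := by
    intro n
    rw [hTn]
    refine hSle _ _ fun k => ?_
    refine norm_taylorCoeff_le (F := fun z => P (φ z) ^ n) (by linarith) (fun z hz => ?_)
      (fun z hz => ?_) k
    · exact (((hPa _).comp (hδU hz).1).pow n).differentiableAt.differentiableWithinAt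
    · rw [norm_pow]
      have := (hδU (Metric.sphere_subset_closedBall hz)).2
      gcongr
      exact (mem_ball_zero_iff.1 this).le
  -- r < 1 is taken so close to 1 that P(rξ) = (1 + r)/2 exceeds q; then ‖Pⁿ‖ decays more slowly
  -- than ‖T(Pⁿ)‖.
  obtain ⟨r, hqr, hr1⟩ := exists_between (show max 0 (2 * q - 1) < 1 by
    rw [max_lt_iff]; constructor <;> linarith)
  have hr0 : 0 < r := (le_max_left _ _).trans_lt hqr
  have hqr' : q < (1 + r) / 2 := by linarith [(le_max_right 0 (2 * q - 1)).trans_lt hqr]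
  have hrξ : ‖(r : ℂ) * ξ‖ < 1 := by
    rw [norm_mul, hξ1, Complex.norm_of_nonneg hr0.le]; linarith
  obtain ⟨Λ, hΛ⟩ := exists_evalCLM W hrξ
  have hbd : ∀ n, (((1 + r) / 2) / q) ^ n ≤ ‖Λ‖ * (c * S) := by
    intro n
    have h1 : Λ (ofAnalytic W (hPn n)) = ((((1 + r) / 2) ^ n : ℝ) : ℂ) := by
      rw [hΛ, eval_ofAnalytic _ hrξ]
      have : conj ξ * (r * ξ) = r := by
        rw [mul_left_comm, conj_mul_self_of_norm_eq_one hξ1, mul_one]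
      simp only [hP, this]
      push_cast
      rfl
    have h2 := Λ.le_opNorm (ofAnalytic W (hPn n))
    rw [h1, Complex.norm_of_nonneg (by positivity)] at h2
    rw [div_pow, div_le_iff₀ (by positivity)]
    calc _ ≤ _ := h2
      _ ≤ ‖Λ‖ * (c * (S * q ^ n)) := by
        gcongr
        refine (hc _).trans ?_
        gcongr
        exact hTle n
      _ = _ := by ring
  obtain ⟨n, hn⟩ := pow_unbounded_of_one_lt (‖Λ‖ * (c * S)) ((one_lt_div hq0).2 hqr')
  exact absurd (hbd n) (not_le.2 hn)

/-! ### The equivalence -/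

theorem isSemiFredholm_of_norm_le {H : Type*} [NormedAddCommGroup H] [InnerProductSpace ℂ H]
    [CompleteSpace H] {T : H →L[ℂ] H} {c : ℝ} (hc : ∀ f, ‖f‖ ≤ c * ‖T f‖) : IsSemiFredholm T := by
  have hanti : AntilipschitzWith c.toNNReal T := T.antilipschitz_of_bound fun f =>
    (hc f).trans (by gcongr; exact Real.le_coe_toNNReal c)
  refine ⟨hanti.isClosed_range T.uniformContinuous, Or.inl ?_⟩
  rw [LinearMap.ker_eq_bot.2 hanti.injective]
  infer_instance

theorem theorem4 (W : WeightSequence) (hW : W.PolynomialGrowth) (φ : ℂ → ℂ)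
    (hφ : AnalyticOnNhd ℂ φ (Metric.closedBall 0 1))
    (hmaps : Set.MapsTo φ (Metric.closedBall 0 1) (Metric.closedBall 0 1))
    (hnonconst : ¬ ∃ c : ℂ, ∀ z ∈ Metric.closedBall (0 : ℂ) 1, φ z = c) :
    ∃ T : WeightedHardy W →L[ℂ] WeightedHardy W,
      IsCompositionOperator φ T ∧
      List.TFAE [
        IsSemiFredholm T,
        IsClosed (Set.range T),
        Metric.sphere (0 : ℂ) 1 ⊆ φ '' Metric.closedBall 0 1,
        ∃ J : Set ℂ, IsArc J ∧ J ⊆ φ '' Metric.sphere 0 1,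
        IsFiniteBlaschkeProduct φ] := by
  have hd := isDiskMap_of_nonconstant hφ hmaps hnonconst
  obtain ⟨T, hT⟩ := hd.exists_isCompositionOperator hW
  refine ⟨T, hT, ?_⟩
  tfae_have 1 → 2 := fun h => h.1
  tfae_have 2 → 3 := fun h => by
    -- Banach's theorem: an injective operator with closed range is bounded below.
    obtain ⟨K, hK⟩ := T.antilipschitz_of_injective_of_isClosed_range (hT.injective hd hnonconst) h
    refine sphere_subset_image_of_norm_le hd hT K.coe_nonneg fun f => ?_
    simpa using hK.le_mul_dist f 0
  tfae_have 3 → 4 := fun h => by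
    -- The whole circle serves as the arc; interior points have |φ| < 1, so preimages lie on the
    -- circle.
    refine ⟨_, isArc_sphere, fun z hz => ?_⟩
    obtain ⟨w, hw, rfl⟩ := h hz
    refine ⟨w, ?_, rfl⟩
    rw [mem_sphere_zero_iff_norm] at hz ⊢
    refine le_antisymm (mem_closedBall_zero_iff.1 hw) (not_lt.1 fun hlt => ?_)
    exact (hd.norm_lt_one w hlt).ne hz
  tfae_have 4 → 5 := fun ⟨J, hJ, hsub⟩ =>
    isFiniteBlaschkeProduct_of_norm_eq_one hφ (norm_eq_one_of_isArc hφ hJ hsub)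
  tfae_have 5 → 1 := fun h => by
    obtain ⟨c, hc⟩ := exists_norm_le_of_inner hW hd h.norm_eq_one hT
    exact isSemiFredholm_of_norm_le hc
  tfae_finish
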